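/- **Setting.** Let $K$ be a non-archimedean local field with residue field of $q$ elements, valuation $v$ normalized by $v(\varpi)=1$ for prime elements $\varpi$, and $|x|=q^{-v(x)}$. Let $V$ be a $K$-vector space of finite dimension $n\ge 1$ with a fixed basis $v_1,\dots,v_n$, and let $G=PGL(V)=GL(V)/K^\times$ with its usual topology. Write $\underline n=\{1,\dots,n\}$. *Seminorms.* A seminorm on $V$ is a map $\gamma:V\to\mathbb R_{\ge0}$, not identically zero, with $\gamma(\lambda v)=|\lambda|\gamma(v)$ and $\gamma(v+w)\le\max\{\gamma(v),\gamma(w)\}$. Let $\mathcal S'$ be the set of seminorms with the topology of pointwise convergence, and let $\mathcal S$ be its quotient (with the quotient topology) by the relation $\gamma_1\sim\gamma_2\iff\gamma_1=c\gamma_2$ for some real $c>0$. $G$ acts on $\mathcal S$ by $g(\gamma)=\gamma\circ g^{-1}$. *Compactified apartment.* For $\emptyset\ne I\subseteq\underline n$ let $A_I$ be the real vector space generated by $\bar\eta_i^I$ ($i\in I$) with the single relation $\sum_{i\in I}\bar\eta_i^I=0$; put $A=A_{\underline n}$, $\eta_i=\bar\eta_i^{\underline n}$. Let $s_I:A\to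 A_I$ be the linear map with $\eta_i\mapsto\bar\eta_i^I$ for $i\in I$ and $\eta_i\mapsto0$ for $i\notin I$. Let $\bar A=\bigsqcup_{\emptyset\neq I\subseteq\underline n}A_I$, with the topology having as a base the open subsets of $A$ and the sets $\Gamma_U^I=\bigcup_{I\subseteq J\subseteq\underline n}s_J\big(U+\sum_{i\notin I}\mathbb R_{\ge0}\eta_i\big)$ for $\emptyset\ne I\subsetneq\underline n$ and $U\subseteq A$ open and bounded. Define $\varphi:\bar A\to\mathcal S$ by sending $\sum_{i\in I}x_i\bar\eta_i^I\in A_I$ to the class of $\sum_i\lambda_iv_i\mapsto\max_{i\in I}|\lambda_i|q^{-x_i}$. *Groups.* Let $T\subset G$ be the image of the diagonal matrices with respect to $v_1,\dots,v_n$, $N$ its normalizer in $G$, so $N=T\rtimes W$ with $W$ the permutation matrices. For $t\in T$ induced by $\mathrm{diag}(d_1,\dots,d_n)$ put $\nu(t)=-\sum_iv(d_i)\eta_i\in A$. $N$ acts on $\bar A$ by an action also denoted $\nu$: $t\in T$ translates $A_I$ by $s_I(\nu(t))$, and $w\in W$ maps $A_I$ to $A_{w(I)}$ by $\bar\eta_i^I\mapsto\bar\eta_{w(i)}^{w(I)}$.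 For $i\ne j$ let $a_{ij}:A\to\mathbb R$, $\sum x_k\eta_k\mapsto x_i-x_j$, and for $x\in\bar A$ let $f_x(a_{ij})=\inf\{t\in\mathbb R:x\in\overline{\{z\in A:a_{ij}(z)\ge-t\}}\}\in[-\infty,\infty]$ (closure in $\bar A$). Let $U_x\subseteq G$ be the subgroup generated, for all $i\ne j$, by the unipotent elements $v_j\mapsto v_j+\omega v_i$, $v_l\mapsto v_l$ $(l\ne j)$ with $v(\omega)\ge f_x(a_{ij})$, let $N_x=\{n\in N:\nu(n)x=x\}$ and $P_x=U_xN_x$. Let $Z=\ker(\nu:T\to A)$ and $U_0^\wedge=U_0Z$, with $0\in A$ the origin. *Compactified building.* On $G\times\bar A$ let $(g,x)\sim(h,y)$ iff there is $n\in N$ with $\nu(n)x=y$ and $g^{-1}hn\in P_x$. Let $\bar X=(U_0^\wedge\times\bar A)/\!\sim$ with the quotient topology, and write $[u,x]$ for the class of $(u,x)$. **Theorem.** The relation $\sim$ is an equivalence relation, and $G=U_0^\wedge NP_x$ for all $x\in\bar A$. There is an action of $G$ on $\bar X$ such that $g\cdot[u,x]=[v,\nu(n)x]$ whenever $gu=vnh$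 with $v\in U_0^\wedge$, $n\in N$, $h\in P_x$. The map $G\times\bar A\to\bar X$, $(g,x)\mapsto g\cdot[1,x]$, is a topological quotient map whose fibres are exactly the classes of $\sim$, so $\bar X=(G\times\bar A)/\!\sim$. The map $G\times\bar A\to\mathcal S$, $(g,x)\mapsto g(\varphi(x))$, induces a $G$-equivariant homeomorphism $\varphi:\bar X\to\mathcal S$; that is, there is a homeomorphism $\Phi:\bar X\to\mathcal S$ with $\Phi(g\cdot[1,x])=g(\varphi(x))$ for all $g\in G$, $x\in\bar A$, and $\Phi(g\cdot z)=g\,\Phi(z)$ for all $g\in G$, $z\in\bar X$. -/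

import Mathlib

open Pointwise Topology

noncomputable section

namespace SeminormBuilding

/-! ### The local field

A non-archimedean local field is a locally compact, nontrivially normed, ultrametric field.  The
normalisation `|ϖ| = q⁻¹` of the absolute value is a hypothesis of the theorem. -/

section LocalField

variable (K : Type*) [NontriviallyNormedField K] [IsUltrametricDist K]

/-- The valuation ring `R = {x : |x| ≤ 1}`. -/
abbrev ValRing : Subring K := (NormedField.valuation (K := K)).integer

/-- The number `q` of elements of the residue field of `K`. -/
def q : ℕ := Nat.card (IsLocalRing.ResidueField (ValRing K))

open scoped NormedField Valued in
theorem finite_residueField [LocallyCompactSpace K] :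
    Finite (IsLocalRing.ResidueField (NormedField.valuation (K := K)).integer) := by
  have : ProperSpace K := ProperSpace.of_nontriviallyNormedField_of_weaklyLocallyCompactSpace K
  have h : IsCompact (((NormedField.valuation (K := K)).integer : Set K)) := by
    convert! isCompact_closedBall (0:K) 1
    ext x
    simp [Valuation.mem_integer_iff, ← NNReal.coe_le_coe]
  have h2 : CompactSpace (Valued.integer K) := isCompact_iff_compactSpace.1 h
  let _ : (Valued.v : Valuation K NNReal).RankOne := 
    inferInstanceAs (NormedField.valuation (K := K)).RankOne
  exact (Valued.integer.compactSpace_iff_completeSpace_and_isDiscreteValuationRing_and_finite_residueField.1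
    h2).2.2

theorem one_lt_q [LocallyCompactSpace K] : 1 < q K := by
  have := finite_residueField K
  exact Finite.one_lt_card

variable {K}

/-- The valuation `v(x)` of a nonzero element, characterised by `|x| = q ^ (-v(x))`. -/
def val (x : K) : ℝ := -Real.logb (q K) ‖x‖

open Classical in
/-- The valuation `v : K → ℤ ∪ {∞}`, with values in the extended reals; `v(0) = ∞`. -/
def valE (x : K) : EReal := if x = 0 then ⊤ else (val x : EReal)

end LocalField

/-! ### Seminorms -/

section Seminorms

variable (K V : Type*) [NontriviallyNormedField K] [AddCommGroup V] [Module K V]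

/-- The set `𝒮'` of (ultrametric, not identically zero) seminorms on `V`. -/
@[ext]
structure NSeminorm where
  toFun : V → ℝ
  nonneg : ∀ v, 0 ≤ toFun v
  ne_zero : ∃ v, toFun v ≠ 0
  smul : ∀ (c : K) (v : V), toFun (c • v) = ‖c‖ * toFun v
  add_le : ∀ v w, toFun (v + w) ≤ max (toFun v) (toFun w)

/-- The topology of pointwise convergence. -/
instance : TopologicalSpace (NSeminorm K V) :=
  TopologicalSpace.induced NSeminorm.toFun inferInstance

/-- Equivalence of seminorms: `γ₁ = c γ₂` for some real `c > 0`. -/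
def nsSetoid : Setoid (NSeminorm K V) where
  r γ₁ γ₂ := ∃ c : ℝ, 0 < c ∧ ∀ v, γ₁.toFun v = c * γ₂.toFun v
  iseqv :=
    { refl := fun _ => ⟨1, one_pos, fun _ => (one_mul _).symm⟩
      symm := by
        rintro γ₁ γ₂ ⟨c, hc, h⟩
        exact ⟨c⁻¹, inv_pos.2 hc, fun v => by rw [h v, inv_mul_cancel_left₀ hc.ne']⟩
      trans := by
        rintro γ₁ γ₂ γ₃ ⟨c, hc, h⟩ ⟨d, hd, h'⟩
        exact ⟨c * d, mul_pos hc hd, fun v => by rw [h v, h' v, mul_assoc]⟩ }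

/-- The set `𝒮` of equivalence (homothety) classes of seminorms. -/
def SemClass : Type _ := Quotient (nsSetoid K V)

/-- The quotient topology. -/
instance : TopologicalSpace (SemClass K V) :=
  inferInstanceAs (TopologicalSpace (Quotient (nsSetoid K V)))

variable {K V}

/-- The class of a seminorm. -/
def SemClass.mk (γ : NSeminorm K V) : SemClass K V := Quotient.mk (nsSetoid K V) γ

theorem SemClass.sound {γ₁ γ₂ : NSeminorm K V}
    (h : ∃ c : ℝ, 0 < c ∧ ∀ v, γ₁.toFun v = c * γ₂.toFun v) :
    SemClass.mk γ₁ = SemClass.mk γ₂ :=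
  Quotient.sound (s := nsSetoid K V) h

/-- `GL(V)` acts on seminorms by `g(γ) = γ ∘ g⁻¹`. -/
instance : MulAction (LinearMap.GeneralLinearGroup K V) (NSeminorm K V) where
  smul g γ :=
    { toFun := fun v => γ.toFun (g⁻¹ • v)
      nonneg := fun v => γ.nonneg _
      ne_zero := by
        obtain ⟨v, hv⟩ := γ.ne_zero
        exact ⟨g • v, by rwa [inv_smul_smul]⟩
      smul := fun c v => by rw [smul_comm, γ.smul]
      add_le := fun v w => by rw [smul_add]; exact γ.add_le _ _ }
  one_smul γ := by
    ext v
    change γ.toFun ((1 : LinearMap.GeneralLinearGroup K V)⁻¹ • v) = _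
    rw [inv_one, one_smul]
  mul_smul g h γ := by
    ext v
    change γ.toFun ((g * h)⁻¹ • v) = γ.toFun (h⁻¹ • g⁻¹ • v)
    rw [mul_inv_rev, mul_smul]

theorem NSeminorm.gl_smul_apply (g : LinearMap.GeneralLinearGroup K V) (γ : NSeminorm K V)
    (v : V) : (g • γ).toFun v = γ.toFun (g⁻¹ • v) := rfl

/-- The induced action of `GL(V)` on `𝒮`. -/
instance : MulAction (LinearMap.GeneralLinearGroup K V) (SemClass K V) where
  smul g := Quotient.map (fun γ => g • γ) (by
    rintro γ₁ γ₂ ⟨c, hc, h⟩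
    exact ⟨c, hc, fun v => h _⟩)
  one_smul s := by
    induction s using Quotient.inductionOn with
    | h γ => exact congrArg SemClass.mk (one_smul _ γ)
  mul_smul g h s := by
    induction s using Quotient.inductionOn with
    | h γ => exact congrArg SemClass.mk (mul_smul g h γ)

theorem SemClass.gl_smul_mk (g : LinearMap.GeneralLinearGroup K V) (γ : NSeminorm K V) :
    g • SemClass.mk γ = SemClass.mk (g • γ) := rfl

end Seminorms

/-! ### The group `G = PGL(V)` -/

section PGL

variable (K V : Type*) [NontriviallyNormedField K] [AddCommGroup V] [Module K V]

/-- The scalars `Kˣ → GL(V)`. -/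
def scalarHom : Kˣ →* LinearMap.GeneralLinearGroup K V :=
  Units.map (algebraMap K (Module.End K V)).toMonoidHom

variable {K V} in
theorem scalarHom_smul (c : Kˣ) (v : V) : scalarHom K V c • v = (c : K) • v := rfl

instance : (scalarHom K V).range.Normal where
  conj_mem := by
    rintro _ ⟨c, rfl⟩ g
    refine ⟨c, ?_⟩
    rw [eq_mul_inv_iff_mul_eq]
    ext v
    exact ((g : V →ₗ[K] V).map_smul (c : K) v).symm

/-- The group `G = PGL(V) = GL(V) / Kˣ` of rational points. -/
def PGL : Type _ := LinearMap.GeneralLinearGroup K V ⧸ (scalarHom K V).range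

instance : Group (PGL K V) :=
  inferInstanceAs (Group (LinearMap.GeneralLinearGroup K V ⧸ (scalarHom K V).range))

/-- The topology of `G`: the quotient of that of `GL(V)`, the group of units of `End(V)`, where
`End(V)` has its canonical topology as a finite-dimensional `K`-vector space. -/
instance : TopologicalSpace (PGL K V) :=
  letI : TopologicalSpace (Module.End K V) := moduleTopology K (Module.End K V)
  inferInstanceAs
    (TopologicalSpace (LinearMap.GeneralLinearGroup K V ⧸ (scalarHom K V).range))

variable {K V}

/-- The projection `GL(V) → PGL(V)`. -/
def PGL.mk : LinearMap.GeneralLinearGroup K V →* PGL K V :=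
  QuotientGroup.mk' (scalarHom K V).range

theorem PGL.mk_surjective : Function.Surjective (PGL.mk (K := K) (V := V)) :=
  QuotientGroup.mk'_surjective _

theorem PGL.mk_eq_mk {g h : LinearMap.GeneralLinearGroup K V} :
    PGL.mk g = PGL.mk h ↔ ∃ c : Kˣ, ∀ v : V, h • v = (c : K) • g • v := by
  have : PGL.mk g = PGL.mk h ↔ g⁻¹ * h ∈ (scalarHom K V).range := QuotientGroup.eq
  rw [this]
  constructor
  · rintro ⟨c, hc⟩
    refine ⟨c, fun v => ?_⟩
    have : h = g * scalarHom K V c := by rw [hc]; group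
    rw [this, mul_smul, scalarHom_smul, smul_comm]
  · rintro ⟨c, hc⟩
    refine ⟨c, ?_⟩
    rw [eq_inv_mul_iff_mul_eq]
    ext v
    have := hc v
    rw [smul_comm, ← scalarHom_smul, ← mul_smul] at this
    exact this.symm

/-- The action of `G` on the set `𝒮` of seminorm classes. -/
instance : MulAction (PGL K V) (SemClass K V) :=
  MulAction.compHom (SemClass K V)
    (QuotientGroup.lift (scalarHom K V).range
      (MulAction.toPermHom (LinearMap.GeneralLinearGroup K V) (SemClass K V)) (by
        rintro _ ⟨c, rfl⟩
        ext s
        induction s using Quotient.inductionOn with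
        | h γ =>
          refine SemClass.sound (γ₁ := scalarHom K V c • γ) ⟨‖((c⁻¹ : Kˣ) : K)‖, ?_, fun v => ?_⟩
          · exact norm_pos_iff.2 (Units.ne_zero _)
          · rw [NSeminorm.gl_smul_apply, ← map_inv, scalarHom_smul, γ.smul]) :
      PGL K V →* Equiv.Perm (SemClass K V))

theorem PGL.mk_smul (g : LinearMap.GeneralLinearGroup K V) (s : SemClass K V) :
    PGL.mk g • s = g • s := rfl

end PGL

/-! ### The apartment and its compactification -/

section Apartment

/-- For a finite index set `J`, the real vector space generated by `η_j` (`j ∈ J`) subject to the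
single relation `∑ η_j = 0`; this is `X_*(T) ⊗ ℝ` for the diagonal torus `T` of `PGL_J`. -/
abbrev Apt (J : Type*) : Type _ := (J → ℝ) ⧸ (Submodule.span ℝ {fun _ : J => (1 : ℝ)})

/-- The point `∑ x_j η_j`. -/
def Apt.mk {J : Type*} (x : J → ℝ) : Apt J := Submodule.Quotient.mk x

/-- The linear map `Apt J → Apt J'`, `∑ x_j η_j ↦ ∑ x_{f j'} η_{j'}`. -/
def Apt.comap {J J' : Type*} (f : J' → J) : Apt J →ₗ[ℝ] Apt J' :=
  Submodule.mapQ _ _ (LinearMap.funLeft ℝ ℝ f) (by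
    rw [Submodule.span_le, Set.singleton_subset_iff]
    exact Submodule.subset_span rfl)

variable (ι : Type*)

/-- `Ā = ⋃_{∅ ≠ I ⊆ ι} A_I` (disjoint union). -/
structure ABar where
  I : Finset ι
  nonempty : I.Nonempty
  pt : Apt I

variable {ι}

/-- The map `s_I : A → A_I`, killing `η_i` for `i ∉ I` and sending `η_i` to `η̄_i` for `i ∈ I`. -/
def sMap (I : Finset ι) : Apt ι →ₗ[ℝ] Apt I := Apt.comap (fun i : I => (i : ι))

/-- The root `a_{ij} : A → ℝ`, `∑ x_k η_k ↦ x_i - x_j`. -/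
def root (i j : ι) : Apt ι →ₗ[ℝ] ℝ :=
  Submodule.liftQ _
    (LinearMap.proj (R := ℝ) (φ := fun _ : ι => ℝ) i - LinearMap.proj (φ := fun _ : ι => ℝ) j) (by
      rw [Submodule.span_le, Set.singleton_subset_iff]
      exact LinearMap.mem_ker.2 (by simp))

/-- The cone `Δ_I = ∑_{i ∉ I} ℝ_{≥ 0} η_i ⊆ A`. -/
def Delta (I : Finset ι) : Set (Apt ι) :=
  {z | ∃ c : ι → ℝ, (∀ i, 0 ≤ c i) ∧ (∀ i ∈ I, c i = 0) ∧ z = Apt.mk c}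

/-- The set `Γ_U^I = ⋃_{I ⊆ J ⊆ ι} s_J (U + Δ_I)`; for `J = ι` the map `s_J` is the
identification of `A` with a subset of `Ā`. -/
def Gam (I : Finset ι) (U : Set (Apt ι)) : Set (ABar ι) :=
  {y | I ⊆ y.I ∧ y.pt ∈ sMap y.I '' (U + Delta I)}

section
variable [Fintype ι] [Nonempty ι]

/-- The inclusion `A = A_ι ⊆ Ā`. -/
def incl (x : Apt ι) : ABar ι := ⟨Finset.univ, Finset.univ_nonempty, sMap Finset.univ x⟩

/-- The topology on `Ā` with base the open subsets of `A` and the sets `Γ_U^I` for nonempty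
`I ⊊ ι` and bounded open `U ⊆ A`. -/
instance : TopologicalSpace (ABar ι) :=
  TopologicalSpace.generateFrom
    ({S | ∃ U : Set (Apt ι), IsOpen U ∧ S = incl '' U} ∪
      {S | ∃ (I : Finset ι) (U : Set (Apt ι)), I.Nonempty ∧ I ≠ Finset.univ ∧ IsOpen U ∧
        Bornology.IsBounded U ∧ S = Gam I U})

/-- `f_x(a_{ij}) = inf {t ∈ ℝ : x ∈ closure of {z ∈ A : a_{ij}(z) ≥ -t} in Ā}`. -/
def fRoot (x : ABar ι) (i j : ι) : EReal :=
  sInf ((fun t : ℝ => (t : EReal)) '' {t : ℝ | x ∈ closure (incl '' {z | -t ≤ root i j z})})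

end

variable {K : Type*} [NontriviallyNormedField K] [IsUltrametricDist K]

/-- For `t` induced by the diagonal matrix with entries `d_i`, the point
`ν(t) = ∑ -v(d_i) η_i` of `A`. -/
def nuT (d : ι → Kˣ) : Apt ι := Apt.mk (fun i => -val (d i : K))

/-- The diagonal torus acts on `A_I` by translation by `s_I(ν(t))`. -/
def torusAct (d : ι → Kˣ) (x : ABar ι) : ABar ι := ⟨x.I, x.nonempty, sMap x.I (nuT d) + x.pt⟩

/-- The permutation `w` maps `A_I` to `A_{w(I)}`, sending `η̄_i` to `η̄_{w(i)}`. -/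
def permAct (w : Equiv.Perm ι) (x : ABar ι) : ABar ι :=
  ⟨x.I.map w.toEmbedding, x.nonempty.map,
    Apt.comap (fun j : x.I.map w.toEmbedding =>
      (⟨w.symm j, (Finset.mem_map_equiv).1 j.2⟩ : x.I)) x.pt⟩

theorem torusAct_smul (c : Kˣ) (d : ι → Kˣ) (x : ABar ι) :
    torusAct (fun i => c * d i) x = torusAct d x := by
  have h : nuT (fun i => c * d i) = nuT d := by
    refine (Submodule.Quotient.eq _).2 ?_
    refine Submodule.mem_span_singleton.2 ⟨-val (c : K), ?_⟩
    funext i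
    have : Real.logb (q K) (‖(c : K)‖ * ‖(d i : K)‖)
        = Real.logb (q K) ‖(c : K)‖ + Real.logb (q K) ‖(d i : K)‖ :=
      Real.logb_mul (norm_ne_zero_iff.2 c.ne_zero) (norm_ne_zero_iff.2 (d i).ne_zero)
    simp [val, this]
  simp only [torusAct, h]

end Apartment

/-! ### Torus, normaliser and root groups -/

section Groups

variable {K : Type*} [NontriviallyNormedField K]
  {V : Type*} [AddCommGroup V] [Module K V] {ι : Type*} (b : Module.Basis ι K V)

/-- The diagonal automorphism `v_i ↦ d_i v_i`. -/
def diagGL (d : ι → Kˣ) : LinearMap.GeneralLinearGroup K V :=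
  LinearMap.GeneralLinearGroup.ofLinearEquiv (b.equiv (b.unitsSMul d) (Equiv.refl ι))

/-- The permutation automorphism `v_i ↦ v_{w(i)}`. -/
def permGL (w : Equiv.Perm ι) : LinearMap.GeneralLinearGroup K V :=
  LinearMap.GeneralLinearGroup.ofLinearEquiv (b.equiv b w)

/-- For `i ≠ j`, the element `v_j ↦ v_j + ω v_i`, `v_l ↦ v_l` (`l ≠ j`) of the root group
of `a_{ij}`: its matrix has the entry `ω` at the place `(i, j)`. -/
def rootGL {i j : ι} (hij : i ≠ j) (ω : K) : LinearMap.GeneralLinearGroup K V :=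
  LinearMap.GeneralLinearGroup.ofLinearEquiv
    (LinearEquiv.transvection (f := b.coord j) (v := ω • b i) (by simp [hij]))

theorem diagGL_smul_basis (d : ι → Kˣ) (i : ι) : diagGL b d • b i = (d i : K) • b i := by
  change (b.equiv (b.unitsSMul d) (Equiv.refl ι)) (b i) = _
  rw [Module.Basis.equiv_apply, Module.Basis.unitsSMul_apply]
  rfl

theorem permGL_smul_basis (w : Equiv.Perm ι) (i : ι) : permGL b w • b i = b (w i) :=
  Module.Basis.equiv_apply _ _ _ _

theorem rootGL_smul {i j : ι} (hij : i ≠ j) (ω : K) (x : V) :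
    rootGL b hij ω • x = x + b.coord j x • ω • b i := rfl

theorem gl_ext {g h : LinearMap.GeneralLinearGroup K V} (H : ∀ i, g • b i = h • b i) : g = h :=
  Units.ext (b.ext H)

/-- The diagonal embedding `(Kˣ)^ι → GL(V)`. -/
def diagHom : (ι → Kˣ) →* LinearMap.GeneralLinearGroup K V where
  toFun := diagGL b
  map_one' := gl_ext b fun i => by simp [diagGL_smul_basis]
  map_mul' d e := gl_ext b fun i => by
    rw [diagGL_smul_basis, mul_smul, diagGL_smul_basis, smul_comm, diagGL_smul_basis, smul_smul]
    rw [Pi.mul_apply, Units.val_mul, mul_comm]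

/-- The torus `T ⊆ G` of classes of diagonal matrices. -/
def T : Subgroup (PGL K V) := (PGL.mk.comp (diagHom b)).range

/-- The normaliser `N` of `T` in `G`. -/
def N : Subgroup (PGL K V) := Subgroup.normalizer (T b : Set (PGL K V))

theorem mono_aux [Fintype ι] (g : LinearMap.GeneralLinearGroup K V)
    (H : ∀ d : ι → Kˣ, ∃ e : ι → K, ∀ l k, b.repr (g • b l) k * d l = e k * b.repr (g • b l) k) :
    ∃ (d : ι → Kˣ) (w : Equiv.Perm ι), ∀ l, g • b l = (d (w l) : K) • b (w l) := by
  classical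
  set m : ι → ι → K := fun k l => b.repr (g • b l) k with hm
  obtain ⟨c, hc⟩ := NormedField.exists_one_lt_norm K
  have hc0 : c ≠ 0 := fun h => by simp [h] at hc; linarith
  have hc1 : c ≠ 1 := fun h => by simp [h] at hc
  have row : ∀ k, ∃ l, m k l ≠ 0 := by
    intro k
    by_contra! h
    have h1 : ∀ v : V, b.repr (g • v) k = 0 := by
      intro v
      have : (b.coord k) ∘ₗ (g : V →ₗ[K] V) = 0 := b.ext fun l => h l
      exact LinearMap.congr_fun this v
    have := h1 (g⁻¹ • b k)
    simp at this
  have uniq : ∀ k l l', m k l ≠ 0 → m k l' ≠ 0 → l = l' := by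
    intro k l l' h h'
    by_contra hne
    obtain ⟨e, he⟩ := H (Function.update 1 l (Units.mk0 c hc0))
    have h1 := he l k
    have h2 := he l' k
    simp only [Function.update_self, Units.val_mk0] at h1
    rw [Function.update_of_ne (Ne.symm hne)] at h2
    change m k l * c = e k * m k l at h1
    change m k l' * (1 : K) = e k * m k l' at h2
    rw [mul_comm] at h1 h2
    exact hc1 ((mul_right_cancel₀ h h1).trans (mul_right_cancel₀ h' h2).symm)
  choose f hf using row
  have col : ∀ k l, l ≠ f k → m k l = 0 := by
    intro k l hl
    by_contra h
    exact hl (uniq k _ _ h (hf k))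
  have surj : Function.Surjective f := by
    intro l
    by_contra! h
    have : g • b l = 0 := by
      apply b.repr.injective
      ext k
      rw [map_zero]
      exact col k l fun hh => h k hh.symm
    have h3 : b l = 0 := by
      have := congrArg (fun v => g⁻¹ • v) this
      simpa using this
    exact b.ne_zero l h3
  let w : Equiv.Perm ι :=
    (Equiv.ofBijective f ⟨Finite.injective_iff_surjective.2 surj, surj⟩).symm
  have hw : ∀ l, f (w l) = l := fun l => Equiv.ofBijective_apply_symm_apply f _ l
  have hw' : ∀ k, w (f k) = k := fun k => Equiv.ofBijective_symm_apply_apply f _ k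
  refine ⟨fun k => Units.mk0 (m k (f k)) (hf k), w, fun l => ?_⟩
  apply b.repr.injective
  ext k
  simp only [Units.val_mk0, map_smul, Module.Basis.repr_self, Finsupp.smul_apply, hw]
  by_cases hk : w l = k
  · subst hk; simp [hm]
  · rw [Finsupp.single_eq_of_ne (Ne.symm hk), smul_zero]
    exact col k l fun h => hk (by rw [h, hw'])

/-- Every element of `N` is the product of an element of `T` and a permutation. -/
theorem exists_monomial [Fintype ι] (n : N b) :
    ∃ (d : ι → Kˣ) (w : Equiv.Perm ι), (n : PGL K V) = PGL.mk (diagGL b d * permGL b w) := by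
  obtain ⟨n, hn⟩ := n
  obtain ⟨g, rfl⟩ := PGL.mk_surjective n
  have H : ∀ d : ι → Kˣ, ∃ e : ι → K, ∀ l k,
      b.repr (g • b l) k * d l = e k * b.repr (g • b l) k := by
    intro d
    have h1 : PGL.mk g * PGL.mk (diagGL b d) * (PGL.mk g)⁻¹ ∈ T b :=
      (Subgroup.mem_normalizer_iff.1 hn _).1 ⟨d, rfl⟩
    obtain ⟨e, he⟩ := h1
    have he' : PGL.mk (diagGL b e * g) = PGL.mk (g * diagGL b d) := by
      rw [map_mul, map_mul, ← eq_mul_inv_iff_mul_eq]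
      exact he
    obtain ⟨c, hc⟩ := PGL.mk_eq_mk.1 he'
    refine ⟨fun k => c * e k, fun l k => ?_⟩
    have h2 := congrArg (fun v => b.repr v k) (hc (b l))
    have h3 : ∀ v : V, b.repr (diagGL b e • v) k = e k * b.repr v k := by
      intro v
      have : (b.coord k) ∘ₗ (diagGL b e : V →ₗ[K] V) = (e k : K) • b.coord k := b.ext fun i => by
        change b.repr (diagGL b e • b i) k = (e k : K) * b.repr (b i) k
        rw [diagGL_smul_basis, map_smul, Module.Basis.repr_self, Finsupp.smul_apply, smul_eq_mul]
        by_cases hik : k = i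
        · rw [hik]
        · rw [Finsupp.single_eq_of_ne hik, mul_zero, mul_zero]
      exact LinearMap.congr_fun this v
    simp only [mul_smul, diagGL_smul_basis, map_smul, Finsupp.smul_apply, h3, smul_eq_mul] at h2
    have h4 : g • (d l : K) • b l = (d l : K) • g • b l := smul_comm _ _ _
    rw [h4, map_smul, Finsupp.smul_apply, smul_eq_mul] at h2
    rw [mul_comm, h2, mul_assoc]
  obtain ⟨d, w, h⟩ := mono_aux b g H
  refine ⟨d, w, congrArg PGL.mk (gl_ext b fun i => ?_)⟩
  rw [h, mul_smul, permGL_smul_basis, diagGL_smul_basis]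

theorem monomial_unique {d d' : ι → Kˣ} {w w' : Equiv.Perm ι}
    (h : PGL.mk (diagGL b d * permGL b w) = PGL.mk (diagGL b d' * permGL b w')) :
    w = w' ∧ ∃ c : Kˣ, d' = fun i => c * d i := by
  obtain ⟨c, hc⟩ := PGL.mk_eq_mk.1 h
  have hl : ∀ l, (d' (w' l) : K) • b (w' l) = ((c : K) * d (w l)) • b (w l) := by
    intro l
    have := hc (b l)
    rwa [mul_smul, mul_smul, permGL_smul_basis, permGL_smul_basis, diagGL_smul_basis,
      diagGL_smul_basis, smul_smul] at this
  have hw : ∀ l, w l = w' l := by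
    intro l
    by_contra hne
    have := congrArg (fun v => b.repr v (w' l)) (hl l)
    simp [Finsupp.single_eq_of_ne (Ne.symm hne)] at this
  refine ⟨Equiv.ext hw, c, ?_⟩
  funext i
  have := congrArg (fun v => b.repr v i) (hl (w.symm i))
  rw [← hw] at this
  ext
  simpa using this

end Groups

section Building

variable {K : Type*} [NontriviallyNormedField K] [IsUltrametricDist K]
  {V : Type*} [AddCommGroup V] [Module K V] {ι : Type*} [Fintype ι]
  (b : Module.Basis ι K V)

/-- The action `ν` of `N = T ⋊ W` on `Ā`: if `n = t w` with `t` diagonal and `w` a permutation,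
then `ν(n) x = t (w x)` (see `nu_eq` for the independence of choices). -/
def nu (n : N b) (x : ABar ι) : ABar ι :=
  torusAct (exists_monomial b n).choose
    (permAct (exists_monomial b n).choose_spec.choose x)

theorem nu_eq {n : N b} {d : ι → Kˣ} {w : Equiv.Perm ι}
    (h : (n : PGL K V) = PGL.mk (diagGL b d * permGL b w)) (x : ABar ι) :
    nu b n x = torusAct d (permAct w x) := by
  have h' := (exists_monomial b n).choose_spec.choose_spec
  obtain ⟨hw, c, hd⟩ := monomial_unique b (h'.symm.trans h)
  rw [hd, torusAct_smul, ← hw]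
  rfl

/-- `N_x = {n ∈ N : ν(n) x = x}`. -/
def Nx (x : ABar ι) : Set (PGL K V) := {g | ∃ n : N b, nu b n x = x ∧ (n : PGL K V) = g}

variable [Nonempty ι]

/-- `U_x` is the subgroup generated by the
`U_{a,x} = {u ∈ U_a : ψ_a(u) ≥ f_x(a)}`, for all roots `a = a_{ij}`, where `ψ_a(u) = v(ω)` if
`ω` is the `(i, j)` entry of `u`. -/
def Ux (x : ABar ι) : Subgroup (PGL K V) :=
  Subgroup.closure
    {g | ∃ (i j : ι) (hij : i ≠ j) (ω : K), fRoot x i j ≤ valE ω ∧ g = PGL.mk (rootGL b hij ω)}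

/-- `P_x = U_x N_x`. -/
def Px (x : ABar ι) : Set (PGL K V) := (Ux b x : Set (PGL K V)) * Nx b x

/-- `Z ⊆ T` is the kernel of `ν : T → A`. -/
def Z : Set (PGL K V) := {g | ∃ d : ι → Kˣ, nuT d = 0 ∧ g = PGL.mk (diagGL b d)}

/-- `U_0^∧ = U_0 Z`, where `0 ∈ A` is the origin. -/
def U0hat : Set (PGL K V) := (Ux b (incl 0) : Set (PGL K V)) * Z b

theorem one_mem_U0hat : (1 : PGL K V) ∈ U0hat b := by
  refine ⟨1, one_mem _, 1, ⟨1, ?_, ?_⟩, one_mul 1⟩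
  · refine (Submodule.Quotient.mk_eq_zero _).2 ?_
    simp only [Pi.one_apply, Units.val_one, val, norm_one, Real.logb_one, neg_zero]
    exact zero_mem _
  · exact ((PGL.mk.comp (diagHom b)).map_one).symm

/-- The relation `(g, x) ∼ (h, y)` iff there is `n ∈ N` with `ν(n) x = y` and
`g⁻¹ h n ∈ P_x`. -/
def BRel (p p' : PGL K V × ABar ι) : Prop :=
  ∃ n : N b, nu b n p.2 = p'.2 ∧ p.1⁻¹ * p'.1 * (n : PGL K V) ∈ Px b p.2

/-- `X̄ = (U_0^∧ × Ā) / ∼`. -/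
def XBar : Type _ :=
  Quot (fun p p' : U0hat b × ABar ι => BRel b ((p.1 : PGL K V), p.2) ((p'.1 : PGL K V), p'.2))

/-- The quotient topology, where `U_0^∧ ⊆ G` has the subspace topology. -/
instance : TopologicalSpace (XBar b) :=
  inferInstanceAs (TopologicalSpace (Quot (fun p p' : U0hat b × ABar ι =>
    BRel b ((p.1 : PGL K V), p.2) ((p'.1 : PGL K V), p'.2))))

/-- The point of `X̄` induced by `(u, x) ∈ U_0^∧ × Ā`. -/
def XBar.mk (u : U0hat b) (x : ABar ι) : XBar b := Quot.mk _ (u, x)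

/-- The point of `X̄` induced by `x ∈ Ā`, i.e. by `(1, x)`. -/
def XBar.ofABar (x : ABar ι) : XBar b := XBar.mk b ⟨1, one_mem_U0hat b⟩ x

end Building

/-! ### The map `φ : Ā → 𝒮` -/

section Phi

variable {K : Type*} [NontriviallyNormedField K] [IsUltrametricDist K]
  {V : Type*} [AddCommGroup V] [Module K V] {ι : Type*}
  (b : Module.Basis ι K V)

theorem semOf_term_le (I : Finset ι) (x : I → ℝ) (v : V) (i : I) :
    ‖b.repr v i‖ * (q K : ℝ) ^ (-x i) ≤ ⨆ j : I, ‖b.repr v j‖ * (q K : ℝ) ^ (-x j) :=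
  le_ciSup (f := fun j : I => ‖b.repr v j‖ * (q K : ℝ) ^ (-x j)) (Set.finite_range _).bddAbove i

variable [LocallyCompactSpace K]

/-- The seminorm `γ(∑ λ_i v_i) = sup {|λ_i| q^{-x_i} : i ∈ I}`. -/
def semOf (I : Finset ι) (hI : I.Nonempty) (x : I → ℝ) : NSeminorm K V where
  toFun v := ⨆ i : I, ‖b.repr v i‖ * (q K : ℝ) ^ (-x i)
  nonneg v := Real.iSup_nonneg fun i =>
    mul_nonneg (norm_nonneg _) (Real.rpow_nonneg (Nat.cast_nonneg _) _)
  ne_zero := by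
    obtain ⟨i, hi⟩ := hI
    refine ⟨b i, ne_of_gt (lt_of_lt_of_le ?_ (semOf_term_le b I x (b i) ⟨i, hi⟩))⟩
    have : (0 : ℝ) < q K := by exact_mod_cast (one_lt_q K).trans' one_pos
    simpa using Real.rpow_pos_of_pos this _
  smul c v := by
    rw [Real.mul_iSup_of_nonneg (norm_nonneg c)]
    simp [mul_assoc]
  add_le v w := by
    have : Nonempty I := hI.to_subtype
    refine ciSup_le fun i => ?_
    have hq : (0 : ℝ) ≤ (q K : ℝ) ^ (-x i) := Real.rpow_nonneg (Nat.cast_nonneg _) _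
    have h : ‖b.repr (v + w) i‖ ≤ max ‖b.repr v i‖ ‖b.repr w i‖ := by
      rw [map_add]
      exact IsUltrametricDist.norm_add_le_max _ _
    refine (mul_le_mul_of_nonneg_right h hq).trans ?_
    rw [max_mul_of_nonneg _ _ hq]
    exact max_le_max (semOf_term_le b I x v i) (semOf_term_le b I x w i)

/-- The map `φ : Ā → 𝒮`, sending `x = ∑_{i ∈ I} x_i η̄_i ∈ A_I` to the class of
`γ(∑ λ_i v_i) = sup {|λ_i| q^{-x_i} : i ∈ I}`. -/
def phi (x : ABar ι) : SemClass K V :=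
  Quotient.liftOn' x.pt (fun y => SemClass.mk (semOf b x.I x.nonempty y)) (by
    intro y z hyz
    rw [Submodule.quotientRel_def, Submodule.mem_span_singleton] at hyz
    obtain ⟨c, hc⟩ := hyz
    have hq : (0 : ℝ) < q K := by exact_mod_cast (one_lt_q K).trans' one_pos
    refine SemClass.sound ⟨(q K : ℝ) ^ (-c), Real.rpow_pos_of_pos hq _, fun v => ?_⟩
    have hyz' : ∀ i, y i = c + z i := fun i => by
      have := congrFun hc i
      simp only [Pi.smul_apply, smul_eq_mul, mul_one, Pi.sub_apply] at this
      linarith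
    change (⨆ i : x.I, _) = _ * ⨆ i : x.I, _
    rw [Real.mul_iSup_of_nonneg (Real.rpow_nonneg hq.le _)]
    refine iSup_congr fun i => ?_
    rw [hyz' i, neg_add, Real.rpow_add hq]
    ring)

theorem phi_mk (I : Finset ι) (hI : I.Nonempty) (y : I → ℝ) :
    phi b ⟨I, hI, Apt.mk y⟩ = SemClass.mk (semOf b I hI y) := rfl

end Phi

end SeminormBuilding
end

open SeminormBuilding

noncomputable section

namespace SeminormBuilding

/-! ### Gaussian elimination with weights -/

section Elimination

variable {K : Type*} [NontriviallyNormedField K]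
  {V : Type*} [AddCommGroup V] [Module K V] {ι : Type*} (b : Module.Basis ι K V)

/-! Encode a point `∑ x_i η̄_i` of `A_I` by its weights `t_i`, proportional to `q ^ (-x_i)` on `I`,
zero off `I`, and of sum one (`wt`). This identifies `Ā` with the standard simplex as a topological
space (`isInducing_wt`, `range_wt`), so `Ā` is compact. The map `φ` now sends a point to the class
of `∑ λ_i v_i ↦ max |λ_i| t_i` (`phi_eq`), and boundary points need no separate treatment: some of
their weights vanish.

In these terms `v(ω) ≥ f_x(a_ij)` says `|ω| t_i ≤ t_j` (`fRoot_le_valE_iff`), and under this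
condition the transvection preserves the seminorm; so `U_x` fixes `φ(x)`. Gaussian elimination, with
pivots that are maximal relative to the weights, gives `G = U_y N U_x` for all `x` and `y`
(`exists_bruhat`). As `φ` is injective and `N`-equivariant, `P_x` is the full stabiliser of `φ(x)`
(`mem_Px_iff`), and `(g, x) ∼ (h, y)` holds iff `g φ(x) = h φ(y)` (`BRel_iff`). Hence `∼` is an
equivalence relation and `X̄ → 𝒮` is well defined and injective.

For surjectivity, every seminorm has an orthogonal basis in the `GL_n(R)`-orbit of the given one,
found by minimising over this compact group (`exists_intGL_smul_semW`). Since `U_0^∧` is the image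
of `GL_n(R)` (`U0hat_eq_image`), `X̄` is compact. A continuous bijection onto the Hausdorff space
`𝒮` is a homeomorphism, and the action on `X̄` is the one transported from `𝒮`. -/

/-- The subgroup of `GL(V)` generated by the elements `v_j ↦ v_j + ω v_i` with
`|ω| t_i ≤ t_j`. -/
def rootSubgroup (t : ι → ℝ) : Subgroup (LinearMap.GeneralLinearGroup K V) :=
  Subgroup.closure
    {g | ∃ (i j : ι) (hij : i ≠ j) (ω : K), ‖ω‖ * t i ≤ t j ∧ g = rootGL b hij ω}

variable {b}

theorem rootGL_mem_rootSubgroup {t : ι → ℝ} {i j : ι} (hij : i ≠ j) {ω : K}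
    (h : ‖ω‖ * t i ≤ t j) : rootGL b hij ω ∈ rootSubgroup b t :=
  Subgroup.subset_closure ⟨i, j, hij, ω, h, rfl⟩

/-- Since `i ∉ s`, the factors do not change the `i`-th coordinate, so their effects simply add up.
Left multiplication by `u` adds multiples of row `i` to the other rows; it clears a pivot column,
and its analogue below clears a pivot row. -/
theorem exists_rootSubgroup_column (t : ι → ℝ) (i : ι) (c : ι → K) (s : Finset ι) (his : i ∉ s)
    (h : ∀ k ∈ s, ‖c k‖ * t k ≤ t i) :
    ∃ u ∈ rootSubgroup b t, ∀ v : V, u • v = v + b.repr v i • ∑ k ∈ s, c k • b k := by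
  classical
  induction s using Finset.induction_on with
  | empty => exact ⟨1, one_mem _, fun v => by simp⟩
  | insert k s hk ih =>
    rw [Finset.mem_insert, not_or] at his
    obtain ⟨u, hu, huv⟩ := ih his.2 fun k hk => h k (Finset.mem_insert_of_mem hk)
    refine ⟨rootGL b (Ne.symm his.1) (c k) * u,
      mul_mem (rootGL_mem_rootSubgroup _ (h k (Finset.mem_insert_self _ _))) hu, fun v => ?_⟩
    have h0 : b.repr (∑ k ∈ s, c k • b k) i = 0 := by
      rw [map_sum, Finsupp.finsetSum_apply]
      refine Finset.sum_eq_zero fun l hl => ?_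
      have : i ≠ l := fun h => his.2 (h ▸ hl)
      simp [Finsupp.single_eq_of_ne this]
    rw [mul_smul, rootGL_smul, huv, Module.Basis.coord_apply, map_add, map_smul,
      Finsupp.add_apply, Finsupp.smul_apply, h0, smul_zero, add_zero, Finset.sum_insert hk,
      smul_add, add_assoc, add_comm (b.repr v i • c k • b k)]

theorem exists_rootSubgroup_row (t : ι → ℝ) (j : ι) (c : ι → K) (s : Finset ι) (hjs : j ∉ s)
    (h : ∀ k ∈ s, ‖c k‖ * t j ≤ t k) :
    ∃ u ∈ rootSubgroup b t, ∀ v : V, u • v = v + (∑ k ∈ s, c k * b.repr v k) • b j := by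
  classical
  induction s using Finset.induction_on with
  | empty => exact ⟨1, one_mem _, fun v => by simp⟩
  | insert k s hk ih =>
    rw [Finset.mem_insert, not_or] at hjs
    obtain ⟨u, hu, huv⟩ := ih hjs.2 fun k hk => h k (Finset.mem_insert_of_mem hk)
    refine ⟨u * rootGL b hjs.1 (c k),
      mul_mem hu (rootGL_mem_rootSubgroup _ (h k (Finset.mem_insert_self _ _))), fun v => ?_⟩
    have h0 : ∑ l ∈ s, c l * b.repr (v + b.repr v k • c k • b j) l
        = ∑ l ∈ s, c l * b.repr v l := by
      refine Finset.sum_congr rfl fun l hl => ?_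
      have : l ≠ j := fun h => hjs.2 (h ▸ hl)
      simp [Finsupp.single_eq_of_ne this]
    rw [mul_smul, rootGL_smul, huv, Module.Basis.coord_apply, h0, Finset.sum_insert hk, add_smul,
      smul_smul, mul_comm (c k), add_assoc]

/-- A pivot for the elimination with weights `s` on rows and `t` on columns. -/
theorem exists_pivot [Fintype ι] (m : ι → ι → K) {s t : ι → ℝ} (hs : ∀ i, 0 ≤ s i)
    (ht : ∀ i, 0 ≤ t i) (S : Finset ι) (hS : ∃ j, j ∉ S) (hm : ∀ j ∉ S, ∃ i, m i j ≠ 0) :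
    ∃ i j, j ∉ S ∧ m i j ≠ 0 ∧ (∀ k, ‖m k j‖ * s k ≤ ‖m i j‖ * s i) ∧
      ∀ l ∉ S, ‖m i l‖ * t j ≤ ‖m i j‖ * t l := by
  classical
  by_cases hz : ∃ j ∉ S, t j = 0
  · obtain ⟨j, hj, htj⟩ := hz
    obtain ⟨i0, hi0⟩ := hm j hj
    obtain ⟨i, hi, hmax⟩ := Finset.exists_max_image (Finset.univ.filter fun i => m i j ≠ 0)
      (fun i => ‖m i j‖ * s i) ⟨i0, by simpa using hi0⟩
    simp only [Finset.mem_filter, Finset.mem_univ, true_and] at hi hmax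
    refine ⟨i, j, hj, hi, fun k => ?_, fun l _ => ?_⟩
    · by_cases hk : m k j = 0
      · rw [hk, norm_zero, zero_mul]
        exact mul_nonneg (norm_nonneg _) (hs i)
      · exact hmax k hk
    · rw [htj, mul_zero]
      exact mul_nonneg (norm_nonneg _) (ht l)
  · have htpos : ∀ j ∉ S, 0 < t j := fun j hj =>
      lt_of_le_of_ne (ht j) fun h => hz ⟨j, hj, h.symm⟩
    obtain ⟨j0, hj0⟩ := hS
    obtain ⟨i0, hi0⟩ := hm j0 hj0
    obtain ⟨⟨i, j⟩, hij, hmax⟩ := Finset.exists_max_image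
      (Finset.univ.filter fun p : ι × ι => p.2 ∉ S ∧ m p.1 p.2 ≠ 0)
      (fun p => ‖m p.1 p.2‖ * s p.1 / t p.2) ⟨(i0, j0), by simpa using ⟨hj0, hi0⟩⟩
    simp only [Finset.mem_filter, Finset.mem_univ, true_and, Prod.forall, and_imp] at hij hmax
    have hmax' : ∀ k, ∀ l ∉ S, ‖m k l‖ * s k / t l ≤ ‖m i j‖ * s i / t j := by
      intro k l hl
      by_cases hk : m k l = 0
      · rw [hk, norm_zero, zero_mul, zero_div]
        exact div_nonneg (mul_nonneg (norm_nonneg _) (hs i)) (ht j)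
      · exact hmax k l hl hk
    -- If `s i > 0`, it cancels from the comparison within row `i`, and the global maximum serves
    -- both conditions.
    rcases (hs i).lt_or_eq with hsi | hsi
    · refine ⟨i, j, hij.1, hij.2, fun k => ?_, fun l hl => ?_⟩
      · exact (div_le_div_iff_of_pos_right (htpos j hij.1)).1 (hmax' k j hij.1)
      · have h := hmax' i l hl
        rw [div_le_div_iff₀ (htpos l hl) (htpos j hij.1)] at h
        refine le_of_mul_le_mul_right ?_ hsi
        linarith
    -- If `s i = 0`, the global maximum is zero, so the column condition holds at every place of row
    -- `i`; the column is then chosen anew to maximise along that row.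
    · obtain ⟨j', hj', hmax2⟩ := Finset.exists_max_image (Finset.univ.filter fun j => j ∉ S)
        (fun j => ‖m i j‖ / t j) ⟨j0, by simpa using hj0⟩
      simp only [Finset.mem_filter, Finset.mem_univ, true_and] at hj' hmax2
      have hne : m i j' ≠ 0 := by
        intro h0
        have h1 := hmax2 j hij.1
        rw [h0, norm_zero, zero_div] at h1
        exact absurd h1 (not_le.2 (div_pos (norm_pos_iff.2 hij.2) (htpos j hij.1)))
      refine ⟨i, j', hj', hne, fun k => ?_, fun l hl => ?_⟩
      · have h := hmax' k j' hj'
        rw [← hsi, mul_zero, zero_div] at h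
        rw [← hsi, mul_zero]
        by_contra! h'
        exact absurd h (not_le.2 (div_pos h' (htpos j' hj')))
      · have h := hmax2 l hl
        rwa [div_le_div_iff₀ (htpos l hl) (htpos j' hj')] at h

theorem exists_repr_smul_ne_zero (g : LinearMap.GeneralLinearGroup K V) (j : ι) :
    ∃ i, b.repr (g • b j) i ≠ 0 := by
  by_contra! h
  have h1 : g • b j = 0 := b.repr.injective (Finsupp.ext fun k => by rw [h, map_zero]; rfl)
  have h2 : b j = 0 := by
    have := congrArg (fun v => g⁻¹ • v) h1
    simpa using this
  exact b.ne_zero j h2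

variable (b) in
/-- The `j`-th column of the matrix of `g` has a single nonzero entry, and this entry is the only
nonzero entry of its row. -/
def IsCleared (g : LinearMap.GeneralLinearGroup K V) (j : ι) : Prop :=
  ∃ i, (∀ k, k ≠ i → b.repr (g • b j) k = 0) ∧ ∀ l, l ≠ j → b.repr (g • b l) i = 0

/-- One elimination step. The pivot inequalities say precisely that the multipliers `m k j / m i j`
and `m i l / m i j` are admissible for the weights `s` and `t`. -/
theorem exists_isCleared_insert [Fintype ι] {s t : ι → ℝ} (hs : ∀ i, 0 ≤ s i) (ht : ∀ i, 0 ≤ t i)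
    (g : LinearMap.GeneralLinearGroup K V) (S : Finset ι) (hS : ∀ j ∈ S, IsCleared b g j)
    (hne : ∃ j, j ∉ S) :
    ∃ u ∈ rootSubgroup b s, ∃ u' ∈ rootSubgroup b t, ∃ j ∉ S,
      IsCleared b (u * g * u') j ∧ ∀ l ∈ S, IsCleared b (u * g * u') l := by
  classical
  obtain ⟨i, j, hj, hij, hcol, hrow⟩ := exists_pivot (fun i j => b.repr (g • b j) i) hs ht S hne
    fun j _ => exists_repr_smul_ne_zero g j
  set m : ι → ι → K := fun i j => b.repr (g • b j) i with hm
  change m i j ≠ 0 at hij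
  change ∀ k, ‖m k j‖ * s k ≤ ‖m i j‖ * s i at hcol
  change ∀ l ∉ S, ‖m i l‖ * t j ≤ ‖m i j‖ * t l at hrow
  have hpos : 0 < ‖m i j‖ := norm_pos_iff.2 hij
  -- The pivot row cannot be the row of an earlier pivot, as that row vanishes outside its own
  -- column. Hence the new operations leave the cleared columns alone.
  have hiS : ∀ l ∈ S, m i l = 0 := by
    intro l hl
    obtain ⟨i1, h1, h2⟩ := hS l hl
    refine h1 i fun h => hij ?_
    rw [h]
    exact h2 j fun h => hj (h ▸ hl)
  obtain ⟨u, hu, huv⟩ := exists_rootSubgroup_column (b := b) s i (fun k => -(m k j / m i j))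
    (Finset.univ.erase i) (Finset.notMem_erase _ _) (fun k _ => by
      rw [norm_neg, norm_div, div_mul_eq_mul_div, div_le_iff₀ hpos, mul_comm (s i)]
      exact hcol k)
  obtain ⟨u', hu', huv'⟩ := exists_rootSubgroup_row (b := b) t j (fun l => -(m i l / m i j))
    (Finset.univ.erase j) (Finset.notMem_erase _ _) (fun l _ => by
      rw [norm_neg, norm_div, div_mul_eq_mul_div, div_le_iff₀ hpos, mul_comm (t l)]
      by_cases hl : l ∈ S
      · rw [hiS l hl, norm_zero, zero_mul]
        exact mul_nonneg (norm_nonneg _) (ht l)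
      · exact hrow l hl)
  have hb' : ∀ l, u' • b l = b l + (if l = j then 0 else -(m i l / m i j)) • b j := by
    intro l
    rw [huv']
    congr 2
    simp only [Module.Basis.repr_self, Finsupp.single_apply, mul_ite, mul_one, mul_zero,
      Finset.sum_ite_eq, Finset.mem_erase, Finset.mem_univ, and_true]
    by_cases h : l = j <;> simp [h]
  have hu2 : ∀ v k, b.repr (u • v) k
      = b.repr v k + b.repr v i * (if k = i then 0 else -(m k j / m i j)) := by
    intro v k
    rw [huv, map_add, Finsupp.add_apply, map_smul, Finsupp.smul_apply, map_sum,
      Finsupp.finsetSum_apply, smul_eq_mul]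
    congr 2
    simp only [map_smul, Module.Basis.repr_self, Finsupp.smul_apply, Finsupp.single_apply,
      smul_eq_mul, mul_ite, mul_one, mul_zero, Finset.sum_ite_eq', Finset.mem_erase,
      Finset.mem_univ, and_true]
    by_cases h : k = i <;> simp [h]
  have key : ∀ k l, b.repr ((u * g * u') • b l) k
      = (m k l + (if l = j then 0 else -(m i l / m i j)) * m k j) +
        (m i l + (if l = j then 0 else -(m i l / m i j)) * m i j) *
          (if k = i then 0 else -(m k j / m i j)) := by
    intro k l
    have h4 : g • (if l = j then 0 else -(m i l / m i j)) • b j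
      = (if l = j then 0 else -(m i l / m i j)) • g • b j := smul_comm _ _ _
    rw [mul_smul, mul_smul, hu2, hb', smul_add, h4]
    simp only [map_add, map_smul, Finsupp.add_apply, Finsupp.smul_apply, smul_eq_mul]
    rfl
  refine ⟨u, hu, u', hu', j, hj, ⟨i, fun k hk => ?_, fun l hl => ?_⟩, fun l hl => ?_⟩
  · rw [key]
    simp only [if_true, if_neg hk]
    field_simp
    ring
  · rw [key]
    simp only [if_true, if_neg hl]
    field_simp
    ring
  · obtain ⟨i1, h1, h2⟩ := hS l hl
    have hlj : l ≠ j := fun h => hj (h ▸ hl)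
    have hi1 : m i1 j = 0 := h2 j hlj.symm
    have hl' : m i l = 0 := hiS l hl
    refine ⟨i1, fun k hk => ?_, fun l' hl' => ?_⟩
    · have h3 : m k l = 0 := h1 k hk
      rw [key, hl', h3]
      simp
    · have h3 : m i1 l' = 0 := h2 l' hl'
      rw [key, hi1, h3]
      simp

theorem exists_forall_isCleared [Fintype ι] {s t : ι → ℝ} (hs : ∀ i, 0 ≤ s i) (ht : ∀ i, 0 ≤ t i)
    (n : ℕ) (g : LinearMap.GeneralLinearGroup K V) (S : Finset ι)
    (hn : Fintype.card ι = n + S.card) (hS : ∀ j ∈ S, IsCleared b g j) :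
    ∃ u ∈ rootSubgroup b s, ∃ u' ∈ rootSubgroup b t, ∀ j, IsCleared b (u * g * u') j := by
  classical
  induction n generalizing g S with
  | zero =>
    have : S = Finset.univ := (Finset.card_eq_iff_eq_univ S).1 (by omega)
    exact ⟨1, one_mem _, 1, one_mem _, fun j => by
      rw [one_mul, mul_one]
      exact hS j (this ▸ Finset.mem_univ j)⟩
  | succ n ih =>
    have hne : ∃ j, j ∉ S := by
      by_contra! h
      rw [Finset.eq_univ_of_forall h, Finset.card_univ] at hn
      omega
    obtain ⟨u, hu, u', hu', j, hj, h1, h2⟩ := exists_isCleared_insert hs ht g S hS hne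
    obtain ⟨v, hv, v', hv', h⟩ := ih (u * g * u') (insert j S)
      (by rw [Finset.card_insert_of_notMem hj]; omega) (by
        intro l hl
        rcases Finset.mem_insert.1 hl with rfl | hl
        · exact h1
        · exact h2 l hl)
    refine ⟨v * u, mul_mem hv hu, u' * v', mul_mem hu' hv', ?_⟩
    simpa only [mul_assoc] using h

/-- Bruhat decomposition with respect to two weights. -/
theorem exists_bruhat [Fintype ι] {s t : ι → ℝ} (hs : ∀ i, 0 ≤ s i) (ht : ∀ i, 0 ≤ t i)
    (g : LinearMap.GeneralLinearGroup K V) :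
    ∃ u ∈ rootSubgroup b s, ∃ (d : ι → Kˣ) (w : Equiv.Perm ι), ∃ u' ∈ rootSubgroup b t,
      g = u * (diagGL b d * permGL b w) * u' := by
  obtain ⟨u, hu, u', hu', h⟩ := exists_forall_isCleared hs ht (Fintype.card ι) g ∅ rfl
    (fun j hj => absurd hj (Finset.notMem_empty j))
  -- Each row now has at most one nonzero entry, so rescaling the columns by `d` amounts to
  -- rescaling the rows, which is what `mono_aux` asks for.
  obtain ⟨d, w, hdw⟩ := mono_aux b (u * g * u') (by
    intro d
    have : ∀ k, ∃ e : K, ∀ l, b.repr ((u * g * u') • b l) k * d l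
        = e * b.repr ((u * g * u') • b l) k := by
      intro k
      by_cases hk : ∃ l, b.repr ((u * g * u') • b l) k ≠ 0
      · obtain ⟨l, hl⟩ := hk
        obtain ⟨i, h1, h2⟩ := h l
        have hki : k = i := by
          by_contra hne
          exact hl (h1 k hne)
        refine ⟨d l, fun l' => ?_⟩
        by_cases hl' : l' = l
        · rw [hl', mul_comm]
        · rw [hki, h2 l' hl', zero_mul, mul_zero]
      · push Not at hk
        exact ⟨0, fun l => by rw [hk l, zero_mul, mul_zero]⟩
    choose e he using this
    exact ⟨e, fun l k => he k l⟩)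
  have hg : u * g * u' = diagGL b d * permGL b w := gl_ext b fun i => by
    rw [hdw, mul_smul, permGL_smul_basis, diagGL_smul_basis]
  refine ⟨u⁻¹, inv_mem hu, d, w, u'⁻¹, inv_mem hu', ?_⟩
  rw [← hg]
  group

end Elimination

/-! ### Monomial automorphisms -/

section Monomial

variable {K : Type*} [NontriviallyNormedField K]
  {V : Type*} [AddCommGroup V] [Module K V] {ι : Type*} (b : Module.Basis ι K V)

theorem monomial_smul_basis (d : ι → Kˣ) (w : Equiv.Perm ι) (i : ι) :
    (diagGL b d * permGL b w) • b i = (d (w i) : K) • b (w i) := by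
  rw [mul_smul, permGL_smul_basis, diagGL_smul_basis]

theorem monomial_inv_smul_basis (d : ι → Kˣ) (w : Equiv.Perm ι) (i : ι) :
    (diagGL b d * permGL b w)⁻¹ • b (w i) = ((d (w i))⁻¹ : K) • b i := by
  rw [inv_smul_eq_iff, smul_comm, monomial_smul_basis, smul_smul,
    inv_mul_cancel₀ (Units.ne_zero _), one_smul]

theorem monomial_conj_rootGL (d : ι → Kˣ) (w : Equiv.Perm ι) {i j : ι} (hij : i ≠ j) (ω : K) :
    (diagGL b d * permGL b w) * rootGL b hij ω * (diagGL b d * permGL b w)⁻¹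
      = rootGL b (w.injective.ne hij) ((d (w i) : K) * ω * (d (w j) : K)⁻¹) := by
  refine gl_ext b fun l => ?_
  obtain ⟨l, rfl⟩ := w.surjective l
  rw [mul_smul, mul_smul, monomial_inv_smul_basis, rootGL_smul, rootGL_smul, smul_add,
    smul_comm _ (_ : K) (b l), monomial_smul_basis, smul_smul, inv_mul_cancel₀ (Units.ne_zero _),
    one_smul, smul_comm _ (_ : K) (_ • b i), smul_comm _ (_ : K) (b i), monomial_smul_basis]
  simp only [map_smul, Module.Basis.coord_apply, Module.Basis.repr_self, smul_smul, smul_eq_mul]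
  by_cases h : j = l
  · subst h
    simp only [Finsupp.single_eq_same]
    congr 2
    ring
  · rw [Finsupp.single_eq_of_ne h, Finsupp.single_eq_of_ne (w.injective.ne h)]
    simp

/-- The condition `‖ω‖ * t i ≤ t j` is homogeneous in `t`, so weights matter only up to the common
factor `c`; the entries of `d` rescale `ω` and the weights compatibly. -/
theorem monomial_conj_mem_rootSubgroup {t t' : ι → ℝ} (d : ι → Kˣ) (w : Equiv.Perm ι)
    {c : ℝ} (hc : 0 < c) (h : ∀ i, t' (w i) = c * (‖(d (w i) : K)‖⁻¹ * t i))
    {u : LinearMap.GeneralLinearGroup K V} (hu : u ∈ rootSubgroup b t) :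
    (diagGL b d * permGL b w) * u * (diagGL b d * permGL b w)⁻¹ ∈ rootSubgroup b t' := by
  have : rootSubgroup b t ≤ (rootSubgroup b t').comap
      (MulAut.conj (diagGL b d * permGL b w)).toMonoidHom := by
    refine (Subgroup.closure_le _).2 ?_
    rintro _ ⟨i, j, hij, ω, hω, rfl⟩
    change (diagGL b d * permGL b w) * rootGL b hij ω * (diagGL b d * permGL b w)⁻¹ ∈
      rootSubgroup b t'
    rw [monomial_conj_rootGL]
    refine rootGL_mem_rootSubgroup _ ?_
    have hi : ‖(d (w i) : K)‖ ≠ 0 := norm_ne_zero_iff.2 (Units.ne_zero _)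
    rw [h, h, norm_mul, norm_mul, norm_inv]
    calc _ = (c * ‖(d (w j) : K)‖⁻¹) * (‖ω‖ * t i) := by field_simp
      _ ≤ (c * ‖(d (w j) : K)‖⁻¹) * t j :=
        mul_le_mul_of_nonneg_left hω (mul_nonneg hc.le (inv_nonneg.2 (norm_nonneg _)))
      _ = _ := by ring
  exact this hu

theorem rootGL_inv {i j : ι} (hij : i ≠ j) (ω : K) :
    (rootGL b hij ω)⁻¹ = rootGL b hij (-ω) := by
  refine inv_eq_of_mul_eq_one_left (gl_ext b fun l => ?_)
  have : b.coord j (b i) = 0 := by simp [Finsupp.single_eq_of_ne hij.symm]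
  rw [mul_smul, rootGL_smul, rootGL_smul, one_smul, map_add, map_smul, map_smul, this]
  simp

theorem le_iSup_weight [Finite ι] (t : ι → ℝ) (v : V) (i : ι) :
    ‖b.repr v i‖ * t i ≤ ⨆ j, ‖b.repr v j‖ * t j :=
  le_ciSup (f := fun j => ‖b.repr v j‖ * t j) (Set.finite_range _).bddAbove i

theorem mk_diagGL_mem_T (d : ι → Kˣ) : PGL.mk (diagGL b d) ∈ T b := ⟨d, rfl⟩

theorem permGL_mul (w w' : Equiv.Perm ι) : permGL b (w * w') = permGL b w * permGL b w' :=
  gl_ext b fun i => by rw [mul_smul]; simp only [permGL_smul_basis]; rfl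

theorem permGL_one : permGL b 1 = 1 :=
  gl_ext b fun i => by rw [permGL_smul_basis, one_smul]; rfl

theorem permGL_inv (w : Equiv.Perm ι) : permGL b w⁻¹ = (permGL b w)⁻¹ :=
  eq_inv_of_mul_eq_one_left (by rw [← permGL_mul, inv_mul_cancel, permGL_one])

theorem permGL_conj_diagGL (d : ι → Kˣ) (w : Equiv.Perm ι) :
    permGL b w * diagGL b d * (permGL b w)⁻¹ = diagGL b (fun i => d (w.symm i)) := by
  rw [mul_inv_eq_iff_eq_mul]
  refine gl_ext b fun i => ?_
  rw [mul_smul, mul_smul, diagGL_smul_basis, permGL_smul_basis, diagGL_smul_basis, smul_comm,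
    permGL_smul_basis, Equiv.symm_apply_apply]

theorem mk_monomial_mem_N (d : ι → Kˣ) (w : Equiv.Perm ι) :
    PGL.mk (diagGL b d * permGL b w) ∈ N b := by
  have hconj : ∀ (w : Equiv.Perm ι) (h : PGL K V), h ∈ T b →
      PGL.mk (permGL b w) * h * (PGL.mk (permGL b w))⁻¹ ∈ T b := by
    rintro w _ ⟨d, rfl⟩
    change PGL.mk (permGL b w) * PGL.mk (diagGL b d) * (PGL.mk (permGL b w))⁻¹ ∈ T b
    rw [← map_inv, ← map_mul, ← map_mul, permGL_conj_diagGL]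
    exact mk_diagGL_mem_T b _
  rw [map_mul]
  refine mul_mem (Subgroup.le_normalizer (mk_diagGL_mem_T b d)) ?_
  refine Subgroup.mem_normalizer_iff.2 fun h => ⟨hconj w h, fun hh => ?_⟩
  -- Membership in the normaliser is an equivalence; its converse half is conjugation by the inverse
  -- permutation.
  have := hconj w⁻¹ _ hh
  rw [permGL_inv, map_inv] at this
  simpa [mul_assoc] using this

end Monomial

/-! ### Seminorms given by weights -/

section Weights

variable {K : Type*} [NontriviallyNormedField K] [IsUltrametricDist K]
  {V : Type*} [AddCommGroup V] [Module K V] {ι : Type*} [Finite ι] (b : Module.Basis ι K V)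

/-- The seminorm `∑ λ_i v_i ↦ max |λ_i| t_i`. -/
def semW (t : ι → ℝ) (ht : ∀ i, 0 ≤ t i) (h : ∃ i, t i ≠ 0) : NSeminorm K V where
  toFun v := ⨆ i, ‖b.repr v i‖ * t i
  nonneg v := Real.iSup_nonneg fun i => mul_nonneg (norm_nonneg _) (ht i)
  ne_zero := by
    obtain ⟨i, hi⟩ := h
    refine ⟨b i, ne_of_gt (lt_of_lt_of_le ?_ (le_iSup_weight b t (b i) i))⟩
    simpa using lt_of_le_of_ne (ht i) hi.symm
  smul c v := by
    rw [Real.mul_iSup_of_nonneg (norm_nonneg c)]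
    simp [mul_assoc]
  add_le v w := by
    have : Nonempty ι := ⟨h.choose⟩
    refine ciSup_le fun i => ?_
    have h : ‖b.repr (v + w) i‖ ≤ max ‖b.repr v i‖ ‖b.repr w i‖ := by
      rw [map_add]
      exact IsUltrametricDist.norm_add_le_max _ _
    refine (mul_le_mul_of_nonneg_right h (ht i)).trans ?_
    rw [max_mul_of_nonneg _ _ (ht i)]
    exact max_le_max (le_iSup_weight b t v i) (le_iSup_weight b t w i)

theorem semW_apply (t : ι → ℝ) (ht : ∀ i, 0 ≤ t i) (h : ∃ i, t i ≠ 0) (v : V) :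
    (semW b t ht h).toFun v = ⨆ i, ‖b.repr v i‖ * t i := rfl

theorem semW_basis (t : ι → ℝ) (ht : ∀ i, 0 ≤ t i) (h : ∃ i, t i ≠ 0) (i : ι) :
    (semW b t ht h).toFun (b i) = t i := by
  classical
  have : Nonempty ι := ⟨i⟩
  refine le_antisymm (ciSup_le fun j => ?_) ?_
  · by_cases hj : j = i
    · subst hj
      simp
    · simp [Finsupp.single_eq_of_ne hj, ht i]
  · refine le_trans ?_ (le_iSup_weight b t (b i) i)
    simp

/-- By the ultrametric inequality a generator does not increase the seminorm; its inverse has the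
same form, so equality holds. -/
theorem rootSubgroup_smul_semW {t : ι → ℝ} (ht : ∀ i, 0 ≤ t i) (h : ∃ i, t i ≠ 0)
    {g : LinearMap.GeneralLinearGroup K V} (hg : g ∈ rootSubgroup b t) :
    g • semW b t ht h = semW b t ht h := by
  have : Nonempty ι := ⟨h.choose⟩
  have key : ∀ (i j : ι) (hij : i ≠ j) (ω : K) (v : V), ‖ω‖ * t i ≤ t j →
      (semW b t ht h).toFun (rootGL b hij ω • v) ≤ (semW b t ht h).toFun v := by
    intro i j hij ω v hω
    rw [rootGL_smul]
    refine ((semW b t ht h).add_le _ _).trans (max_le le_rfl ?_)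
    rw [(semW b t ht h).smul, (semW b t ht h).smul, semW_basis, Module.Basis.coord_apply]
    exact (mul_le_mul_of_nonneg_left hω (norm_nonneg _)).trans (le_iSup_weight b t v j)
  suffices rootSubgroup b t ≤ MulAction.stabilizer _ (semW b t ht h) from this hg
  refine (Subgroup.closure_le _).2 ?_
  rintro _ ⟨i, j, hij, ω, hω, rfl⟩
  refine MulAction.mem_stabilizer_iff.2 (NSeminorm.ext (funext fun v => le_antisymm ?_ ?_))
  · rw [NSeminorm.gl_smul_apply, rootGL_inv]
    exact key i j hij _ _ (by rwa [norm_neg])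
  · rw [NSeminorm.gl_smul_apply]
    conv_lhs => rw [← smul_inv_smul (rootGL b hij ω) v]
    exact key i j hij _ _ hω

/-- Homothetic weights give rise to the same class. -/
theorem mk_semW_eq_iff {s t : ι → ℝ} (hs : ∀ i, 0 ≤ s i) (hs' : ∃ i, s i ≠ 0) (ht : ∀ i, 0 ≤ t i)
    (ht' : ∃ i, t i ≠ 0) :
    SemClass.mk (semW b s hs hs') = SemClass.mk (semW b t ht ht') ↔
      ∃ c : ℝ, 0 < c ∧ ∀ i, s i = c * t i := by
  constructor
  · intro h
    obtain ⟨c, hc, h⟩ := Quotient.exact (s := nsSetoid K V) h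
    refine ⟨c, hc, fun i => ?_⟩
    have := h (b i)
    rwa [semW_basis, semW_basis] at this
  · rintro ⟨c, hc, h⟩
    refine SemClass.sound ⟨c, hc, fun v => ?_⟩
    rw [semW_apply, semW_apply, Real.mul_iSup_of_nonneg hc.le]
    refine iSup_congr fun i => ?_
    rw [h i]
    ring

end Weights

/-! ### The topology of the compactified apartment -/

section ApartmentTopology

variable {ι : Type*}

theorem Apt.mk_surjective {J : Type*} : Function.Surjective (Apt.mk (J := J)) :=
  Submodule.Quotient.mk_surjective _

theorem Apt.mk_eq_mk {J : Type*} {y z : J → ℝ} :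
    Apt.mk y = Apt.mk z ↔ ∃ c : ℝ, ∀ i, y i = c + z i := by
  refine (Submodule.Quotient.eq _).trans (Submodule.mem_span_singleton.trans ?_)
  refine exists_congr fun c => ⟨fun h i => ?_, fun h => funext fun i => ?_⟩
  · have := congrFun h i
    simp only [Pi.smul_apply, smul_eq_mul, mul_one, Pi.sub_apply] at this
    linarith
  · simp [h i]

theorem root_mk (i j : ι) (x : ι → ℝ) : root i j (Apt.mk x) = x i - x j := rfl

theorem Apt.mk_root (i : ι) (z : Apt ι) : Apt.mk (fun k => root k i z) = z := by
  obtain ⟨x, rfl⟩ := Apt.mk_surjective z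
  exact Apt.mk_eq_mk.2 ⟨-x i, fun k => by rw [root_mk]; ring⟩

theorem ABar.ext_pt {x y : ABar ι} (hI : x.I = y.I) (z : ι → ℝ)
    (hx : x.pt = Apt.mk fun i : x.I => z i) (hy : y.pt = Apt.mk fun i : y.I => z i) : x = y := by
  obtain ⟨I, hI', p⟩ := x
  obtain ⟨J, hJ', r⟩ := y
  dsimp only at hI hx hy
  subst hI
  rw [hx, hy]

open Classical in
/-- The weights `Q ^ (-y_i)` of a vector `y ∈ ℝ^I`, extended by zero. -/
def rawWt (Q : ℝ) (I : Finset ι) (y : I → ℝ) (i : ι) : ℝ :=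
  if h : i ∈ I then Q ^ (-y ⟨i, h⟩) else 0

section
variable {Q : ℝ} (hQ : 0 < Q) (I : Finset ι) (y : I → ℝ)

theorem rawWt_of_mem {i : ι} (h : i ∈ I) : rawWt Q I y i = Q ^ (-y ⟨i, h⟩) := dif_pos h

theorem rawWt_of_notMem {i : ι} (h : i ∉ I) : rawWt Q I y i = 0 := dif_neg h

include hQ

theorem rawWt_nonneg (i : ι) : 0 ≤ rawWt Q I y i := by
  by_cases h : i ∈ I
  · rw [rawWt_of_mem I y h]
    exact Real.rpow_nonneg hQ.le _
  · rw [rawWt_of_notMem I y h]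

theorem rawWt_pos {i : ι} (h : i ∈ I) : 0 < rawWt Q I y i := by
  rw [rawWt_of_mem I y h]
  exact Real.rpow_pos_of_pos hQ _

theorem sum_rawWt_pos [Fintype ι] (hI : I.Nonempty) : 0 < ∑ j, rawWt Q I y j := by
  obtain ⟨i, hi⟩ := hI
  exact Finset.sum_pos' (fun j _ => rawWt_nonneg hQ I y j)
    ⟨i, Finset.mem_univ i, rawWt_pos hQ I y hi⟩

end

/-! ### `Ā` as a set: the standard simplex of normalised weights. -/

variable [Fintype ι]

/-- The normalised weights of a point of `Ā`: proportional to `Q ^ (-x_i)` for `i ∈ I` and zero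
for `i ∉ I`, with sum one. -/
def wt (Q : ℝ) (x : ABar ι) (i : ι) : ℝ :=
  rawWt Q x.I (Function.surjInv Apt.mk_surjective x.pt) i /
    ∑ j, rawWt Q x.I (Function.surjInv Apt.mk_surjective x.pt) j

variable {Q : ℝ} (hQ : 1 < Q)
include hQ

/-- `wt` is built on a chosen representative; another one multiplies all raw weights by a common
factor, which the normalisation removes. -/
theorem wt_mk (I : Finset ι) (hI : I.Nonempty) (y : I → ℝ) (i : ι) :
    wt Q ⟨I, hI, Apt.mk y⟩ i = rawWt Q I y i / ∑ j, rawWt Q I y j := by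
  have hQ0 : 0 < Q := one_pos.trans hQ
  obtain ⟨c, hc⟩ := Apt.mk_eq_mk.1
    (Function.surjInv_eq Apt.mk_surjective (Apt.mk y))
  have h : ∀ i, rawWt Q I (Function.surjInv Apt.mk_surjective (Apt.mk y)) i
      = Q ^ (-c) * rawWt Q I y i := by
    intro i
    by_cases hi : i ∈ I
    · rw [rawWt_of_mem _ _ hi, rawWt_of_mem _ _ hi, hc, neg_add, Real.rpow_add hQ0]
    · rw [rawWt_of_notMem _ _ hi, rawWt_of_notMem _ _ hi, mul_zero]
  simp only [wt, h]
  rw [← Finset.mul_sum, mul_div_mul_left _ _ (Real.rpow_pos_of_pos hQ0 _).ne']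

theorem wt_nonneg (x : ABar ι) (i : ι) : 0 ≤ wt Q x i :=
  div_nonneg (rawWt_nonneg (one_pos.trans hQ) _ _ _)
    (sum_rawWt_pos (one_pos.trans hQ) _ _ x.nonempty).le

theorem wt_pos_iff (x : ABar ι) (i : ι) : 0 < wt Q x i ↔ i ∈ x.I := by
  constructor
  · intro h
    by_contra hi
    rw [wt, rawWt_of_notMem _ _ hi, zero_div] at h
    exact h.false
  · intro h
    exact div_pos (rawWt_pos (one_pos.trans hQ) _ _ h)
      (sum_rawWt_pos (one_pos.trans hQ) _ _ x.nonempty)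

theorem sum_wt (x : ABar ι) : ∑ i, wt Q x i = 1 := by
  simp only [wt]
  rw [← Finset.sum_div, div_self (sum_rawWt_pos (one_pos.trans hQ) _ _ x.nonempty).ne']

theorem exists_wt_ne_zero (x : ABar ι) : ∃ i, wt Q x i ≠ 0 :=
  ⟨x.nonempty.choose, ((wt_pos_iff hQ x _).2 x.nonempty.choose_spec).ne'⟩

theorem pt_eq (x : ABar ι) : x.pt = Apt.mk (fun i : x.I => -Real.logb Q (wt Q x i)) := by
  have hQ0 : 0 < Q := one_pos.trans hQ
  obtain ⟨I, hI, p⟩ := x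
  obtain ⟨y, rfl⟩ := Apt.mk_surjective p
  refine Apt.mk_eq_mk.2 ⟨-Real.logb Q (∑ j, rawWt Q I y j), fun i => ?_⟩
  change y i = _ + -Real.logb Q (wt Q ⟨I, hI, Apt.mk y⟩ i)
  rw [wt_mk hQ, Real.logb_div (rawWt_pos hQ0 _ _ i.2).ne' (sum_rawWt_pos hQ0 _ _ hI).ne',
    rawWt_of_mem I y i.2, Real.logb_rpow hQ0 hQ.ne']
  ring

theorem wt_injective : Function.Injective (wt Q : ABar ι → ι → ℝ) := by
  intro x y h
  refine ABar.ext_pt (Finset.ext fun i => ?_) (fun i => -Real.logb Q (wt Q x i))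
    (pt_eq hQ x) ?_
  · rw [← wt_pos_iff hQ, ← wt_pos_iff hQ, h]
  · rw [h]
    exact pt_eq hQ y

theorem wt_mem_stdSimplex (x : ABar ι) : wt Q x ∈ stdSimplex ℝ ι :=
  ⟨wt_nonneg hQ x, sum_wt hQ x⟩

theorem exists_wt_eq {t : ι → ℝ} (ht : t ∈ stdSimplex ℝ ι) : ∃ x : ABar ι, wt Q x = t := by
  classical
  have hne : (Finset.univ.filter fun i => 0 < t i).Nonempty := by
    by_contra h
    rw [Finset.not_nonempty_iff_eq_empty, Finset.filter_eq_empty_iff] at h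
    have : ∑ i, t i ≤ 0 := Finset.sum_nonpos fun i hi => not_lt.1 (h hi)
    rw [ht.2] at this
    linarith
  refine ⟨⟨_, hne, Apt.mk fun i => -Real.logb Q (t i)⟩, funext fun i => ?_⟩
  have h : ∀ i, rawWt Q (Finset.univ.filter fun i => 0 < t i) (fun i => -Real.logb Q (t i)) i
      = t i := by
    intro i
    by_cases hi : 0 < t i
    · rw [rawWt_of_mem _ _ (by simpa using hi), neg_neg,
        Real.rpow_logb (one_pos.trans hQ) hQ.ne' hi]
    · rw [rawWt_of_notMem _ _ (by simpa using hi)]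
      exact le_antisymm (ht.1 i) (not_lt.1 hi)
  rw [wt_mk hQ]
  simp only [h]
  rw [ht.2, div_one]

omit hQ [Fintype ι] in
theorem continuous_root (i j : ι) : Continuous (root i j : Apt ι → ℝ) :=
  continuous_coinduced_dom.2 (show Continuous fun x : ι → ℝ => x i - x j by fun_prop)

omit hQ in
theorem continuous_aptMk {J : Type*} : Continuous (Apt.mk : (J → ℝ) → Apt J) :=
  continuous_quotient_mk'

-- The representative whose `i`-th coordinate is zero has the numbers `root k i z` as coordinates,
-- and its sup norm bounds the quotient norm.
omit hQ in
theorem isBounded_of_root [Nonempty ι] {U : Set (Apt ι)} (i : ι) (C : ℝ)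
    (h : ∀ z ∈ U, ∀ k, |root k i z| ≤ C) : Bornology.IsBounded U := by
  refine isBounded_iff_forall_norm_le.2 ⟨C, fun z hz => ?_⟩
  rw [← Apt.mk_root i z]
  refine (Submodule.Quotient.norm_mk_le _ _).trans ?_
  exact (pi_norm_le_iff_of_nonempty _).2 (h z hz)

variable [Nonempty ι]

/-- Only roots occur on the right, which makes continuity on `A` evident. -/
theorem wt_incl (z : Apt ι) (i : ι) : wt Q (incl z) i = (∑ j, Q ^ root i j z)⁻¹ := by
  have hQ0 : 0 < Q := one_pos.trans hQ
  obtain ⟨x, rfl⟩ := Apt.mk_surjective z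
  have h : ∀ i, rawWt Q Finset.univ (fun i : (Finset.univ : Finset ι) => x i) i = Q ^ (-x i) :=
    fun i => rawWt_of_mem _ _ (Finset.mem_univ i)
  change wt Q ⟨Finset.univ, Finset.univ_nonempty, Apt.mk fun i => x i⟩ i = _
  rw [wt_mk hQ]
  simp only [h, root_mk]
  rw [div_eq_iff, inv_mul_eq_div, eq_div_iff, Finset.mul_sum]
  · refine Finset.sum_congr rfl fun j _ => ?_
    rw [← Real.rpow_add hQ0]
    ring_nf
  · exact (Finset.sum_pos (fun j _ => Real.rpow_pos_of_pos hQ0 _) Finset.univ_nonempty).ne'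
  · exact (Finset.sum_pos (fun j _ => Real.rpow_pos_of_pos hQ0 _) Finset.univ_nonempty).ne'

theorem continuous_wt_incl : Continuous fun z : Apt ι => wt Q (incl z) := by
  have hQ0 : 0 < Q := one_pos.trans hQ
  refine continuous_pi fun i => ?_
  simp only [wt_incl hQ]
  refine Continuous.inv₀ (continuous_finsetSum _ fun j _ =>
    Continuous.rpow continuous_const (continuous_root i j) fun z => Or.inl hQ0.ne') fun z => ?_
  exact (Finset.sum_pos (fun j _ => Real.rpow_pos_of_pos hQ0 _) Finset.univ_nonempty).ne'

theorem eq_incl_of_wt_pos {x : ABar ι} (h : ∀ i, 0 < wt Q x i) :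
    x = incl (Apt.mk fun i => -Real.logb Q (wt Q x i)) := by
  refine ABar.ext_pt (Finset.eq_univ_of_forall fun i => (wt_pos_iff hQ x i).1 (h i))
    (fun i => -Real.logb Q (wt Q x i)) (pt_eq hQ x) rfl

theorem wt_incl_pos (z : Apt ι) (i : ι) : 0 < wt Q (incl z) i :=
  (wt_pos_iff hQ _ _).2 (Finset.mem_univ i)

omit hQ in
theorem incl_injective : Function.Injective (incl : Apt ι → ABar ι) := by
  intro z z' h
  obtain ⟨x, rfl⟩ := Apt.mk_surjective z
  obtain ⟨x', rfl⟩ := Apt.mk_surjective z'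
  have h' : (Apt.mk fun i : (Finset.univ : Finset ι) => x i) =
      Apt.mk fun i : (Finset.univ : Finset ι) => x' i := by
    injection h
  obtain ⟨c, hc⟩ := Apt.mk_eq_mk.1 h'
  exact Apt.mk_eq_mk.2 ⟨c, fun i => hc ⟨i, Finset.mem_univ i⟩⟩

/-! ### `Ā` as a space: the basic open sets in terms of weights. -/

theorem mem_incl_image_iff (U : Set (Apt ι)) (x : ABar ι) :
    x ∈ incl '' U ↔ (∀ i, 0 < wt Q x i) ∧ Apt.mk (fun i => -Real.logb Q (wt Q x i)) ∈ U := by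
  constructor
  · rintro ⟨z, hz, rfl⟩
    refine ⟨wt_incl_pos hQ z, ?_⟩
    rwa [← incl_injective (eq_incl_of_wt_pos hQ (wt_incl_pos hQ z))]
  · rintro ⟨h, hU⟩
    exact ⟨_, hU, (eq_incl_of_wt_pos hQ h).symm⟩

-- Adding a nonnegative multiple of `η_i` with `i ∉ I` lowers the `i`-th weight, and passing to a
-- face `J` makes the weights off `J` vanish. So `Γ_U^I` consists of the points whose weights agree
-- on `I` with those of a point of `U`, suitably scaled, and are bounded by them elsewhere.
omit [Nonempty ι] in
theorem mem_Gam_iff (I : Finset ι) (U : Set (Apt ι)) (x : ABar ι) :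
    x ∈ Gam I U ↔ ∃ a : ι → ℝ, (∀ i, 0 < a i) ∧ Apt.mk (fun i => -Real.logb Q (a i)) ∈ U ∧
      (∀ i ∈ I, wt Q x i = a i) ∧ ∀ i, wt Q x i ≤ a i := by
  classical
  have hQ0 : 0 < Q := one_pos.trans hQ
  constructor
  · rintro ⟨hI, _, ⟨u, hu, _, ⟨c, hc, hcI, rfl⟩, rfl⟩, hx⟩
    obtain ⟨y, rfl⟩ := Apt.mk_surjective u
    rw [pt_eq hQ x] at hx
    obtain ⟨κ, hκ⟩ := Apt.mk_eq_mk.1 hx.symm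
    have hw : ∀ i ∈ x.I, wt Q x i = Q ^ (-(κ + y i) + -c i) := by
      intro i hi
      have h := hκ ⟨i, hi⟩
      change -Real.logb Q (wt Q x i) = κ + (y i + c i) at h
      rw [← Real.rpow_logb hQ0 hQ.ne' ((wt_pos_iff hQ x i).2 hi), ← neg_neg (Real.logb _ _), h]
      ring_nf
    refine ⟨fun i => Q ^ (-(κ + y i)), fun i => Real.rpow_pos_of_pos hQ0 _, ?_, fun i hi => ?_,
      fun i => ?_⟩
    · convert hu using 1
      refine Apt.mk_eq_mk.2 ⟨κ, fun i => ?_⟩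
      rw [Real.logb_rpow hQ0 hQ.ne', neg_neg]
    · rw [hw i (hI hi), hcI i hi, neg_zero, add_zero]
    · by_cases hi : i ∈ x.I
      · rw [hw i hi]
        exact Real.rpow_le_rpow_of_exponent_le hQ.le (by linarith [hc i])
      · exact (not_lt.1 fun h => hi ((wt_pos_iff hQ x i).1 h)).trans
          (Real.rpow_pos_of_pos hQ0 _).le
  · rintro ⟨a, ha, haU, haI, hle⟩
    -- Where the weight of `x` vanishes, the coordinate is killed by `s_J` and the cone coefficient
    -- may be anything nonnegative; zero is taken.
    refine ⟨fun i hi => (wt_pos_iff hQ x i).1 (haI i hi ▸ ha i), _,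
      ⟨_, haU, _, ⟨fun i => if 0 < wt Q x i then Real.logb Q (a i) - Real.logb Q (wt Q x i) else 0,
        fun i => ?_, fun i hi => ?_, rfl⟩, rfl⟩, ?_⟩
    · dsimp only
      split_ifs with h
      · exact sub_nonneg.2 (Real.logb_le_logb_of_le hQ h (hle i))
      · exact le_rfl
    · dsimp only
      rw [haI i hi, sub_self, ite_self]
    · rw [pt_eq hQ x]
      refine Apt.mk_eq_mk.2 ⟨0, fun i => ?_⟩
      change -Real.logb Q (a i) + (if 0 < wt Q x i then _ else _) = _
      rw [if_pos ((wt_pos_iff hQ x i).2 i.2)]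
      ring

omit [Nonempty ι] [Fintype ι] hQ in
theorem continuousAt_aptMk_logb {a : ι → ℝ} (ha : ∀ i, 0 < a i) :
    ContinuousAt (fun a : ι → ℝ => Apt.mk fun i => -Real.logb Q (a i)) a := by
  refine continuous_aptMk.continuousAt.comp (continuousAt_pi.2 fun i => ?_)
  exact (((continuousAt_apply i a).log (ha i).ne').div_const (Real.log Q)).neg

/-- At a boundary point `x ∈ A_I`, fix `i ∈ I` and control the ratios `wt l / wt i` on `Γ_U^I` for a
box `U`. For `l ∈ I` they stay near their values at `x`; for `l ∉ I` they are only bounded above, by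
a quantity that is small when the box is centred at a large `M`. -/
theorem continuous_wt : Continuous (wt Q : ABar ι → ι → ℝ) := by
  have hQ0 : 0 < Q := one_pos.trans hQ
  refine continuous_iff_continuousAt.2 fun x => ?_
  by_cases hx : x.I = Finset.univ
  · have hpos : ∀ i, 0 < wt Q x i := fun i => (wt_pos_iff hQ x i).2 (hx ▸ Finset.mem_univ i)
    obtain ⟨z, rfl⟩ : ∃ z, x = incl z := ⟨_, eq_incl_of_wt_pos hQ hpos⟩
    intro O hO
    obtain ⟨U, hU, hUo, hz⟩ := mem_nhds_iff.1 ((continuous_wt_incl hQ).continuousAt hO)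
    refine Filter.mem_map.2 (Filter.mem_of_superset (IsOpen.mem_nhds
      (TopologicalSpace.isOpen_generateFrom_of_mem (Or.inl ⟨U, hUo, rfl⟩))
      (Set.mem_image_of_mem _ hz)) ?_)
    rintro _ ⟨z', hz', rfl⟩
    exact hU hz'
  · obtain ⟨i, hi⟩ := x.nonempty
    have hwi : 0 < wt Q x i := (wt_pos_iff hQ x i).2 hi
    -- basic neighbourhoods
    have nhd : ∀ (δ M : ℝ), 0 < δ → ∃ S ∈ 𝓝 x, ∀ y ∈ S, 0 < wt Q y i ∧ ∃ ρ : ι → ℝ,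
        (∀ l ∈ x.I, |ρ l - (Real.logb Q (wt Q x i) - Real.logb Q (wt Q x l))| < δ) ∧
        (∀ l ∉ x.I, |ρ l - M| < δ) ∧ (∀ l ∈ x.I, wt Q y l / wt Q y i = Q ^ (-ρ l)) ∧
        ∀ l, wt Q y l / wt Q y i ≤ Q ^ (-ρ l) := by
      intro δ M hδ
      classical
      set r : ι → ℝ := fun l => if l ∈ x.I then
        Real.logb Q (wt Q x i) - Real.logb Q (wt Q x l) else M with hr
      set U : Set (Apt ι) := {z | ∀ l, |root l i z - r l| < δ} with hU
      have hUo : IsOpen U := by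
        rw [hU, Set.ofPred_forall]
        refine isOpen_iInter_of_finite fun l => ?_
        exact isOpen_lt ((continuous_root l i).sub continuous_const).abs continuous_const
      have hUb : Bornology.IsBounded U := by
        refine isBounded_of_root i (δ + ∑ l, |r l|) fun z hz l => ?_
        have h1 := hz l
        have h2 : |r l| ≤ ∑ l, |r l| :=
          Finset.single_le_sum (fun k _ => abs_nonneg (r k)) (Finset.mem_univ l)
        have h3 := abs_sub_abs_le_abs_sub (root l i z) (r l)
        linarith
      refine ⟨Gam x.I U, IsOpen.mem_nhds (TopologicalSpace.isOpen_generateFrom_of_mem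
        (Or.inr ⟨x.I, U, x.nonempty, hx, hUo, hUb, rfl⟩)) ?_, fun y hy => ?_⟩
      · refine (mem_Gam_iff hQ _ _ _).2 ⟨fun l => if l ∈ x.I then wt Q x l else
          Q ^ (-M) * wt Q x i, fun l => ?_, fun l => ?_, fun l hl => ?_, fun l => ?_⟩
        · dsimp only
          split_ifs with hl
          · exact (wt_pos_iff hQ x l).2 hl
          · exact mul_pos (Real.rpow_pos_of_pos hQ0 _) hwi
        · rw [root_mk, hr]
          dsimp only
          rw [if_pos hi]
          split_ifs with hl
          · ring_nf
            simpa using hδ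
          · rw [Real.logb_mul (Real.rpow_pos_of_pos hQ0 _).ne' hwi.ne',
              Real.logb_rpow hQ0 hQ.ne']
            ring_nf
            simpa using hδ
        · exact (if_pos hl).symm
        · dsimp only
          split_ifs with hl
          · exact le_rfl
          · exact (not_lt.1 fun h => hl ((wt_pos_iff hQ x l).1 h)).trans
              (mul_pos (Real.rpow_pos_of_pos hQ0 _) hwi).le
      · obtain ⟨a, ha, haU, haI, hle⟩ := (mem_Gam_iff hQ _ _ _).1 hy
        have hyi : wt Q y i = a i := haI i hi
        have hρ : ∀ l, Q ^ (-(Real.logb Q (a i) - Real.logb Q (a l))) = a l / a i := by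
          intro l
          rw [neg_sub, Real.rpow_sub hQ0, Real.rpow_logb hQ0 hQ.ne' (ha l),
            Real.rpow_logb hQ0 hQ.ne' (ha i)]
        have hd : ∀ l, |(Real.logb Q (a i) - Real.logb Q (a l)) - r l| < δ := by
          intro l
          have h := haU l
          rw [root_mk] at h
          convert h using 2
          ring
        refine ⟨hyi ▸ ha i, fun l => Real.logb Q (a i) - Real.logb Q (a l), fun l hl => ?_,
          fun l hl => ?_, fun l hl => ?_, fun l => ?_⟩
        · have h := hd l
          simp only [hr] at h
          rwa [if_pos hl] at h
        · have h := hd l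
          simp only [hr] at h
          rwa [if_neg hl] at h
        · rw [hρ, haI l hl, hyi]
        · rw [hρ, hyi]
          exact div_le_div_of_nonneg_right (hle l) (ha i).le
    have hratio : Filter.Tendsto (fun y => fun l => wt Q y l / wt Q y i) (𝓝 x)
        (𝓝 fun l => wt Q x l / wt Q x i) := by
      refine tendsto_pi_nhds.2 fun l => Metric.tendsto_nhds.2 fun ε hε => ?_
      by_cases hl : l ∈ x.I
      · have hc : ContinuousAt (fun s : ℝ => Q ^ (-s))
            (Real.logb Q (wt Q x i) - Real.logb Q (wt Q x l)) :=
          (continuous_const.rpow continuous_neg fun _ => Or.inl hQ0.ne').continuousAt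
        obtain ⟨δ, hδ, hδ'⟩ := Metric.continuousAt_iff.1 hc ε hε
        obtain ⟨S, hS, h⟩ := nhd δ 0 hδ
        filter_upwards [hS] with y hy
        obtain ⟨-, ρ, h1, -, h3, -⟩ := h y hy
        have h4 := hδ' (show dist (ρ l) _ < δ from h1 l hl)
        rwa [neg_sub, Real.rpow_sub hQ0, Real.rpow_logb hQ0 hQ.ne' hwi,
          Real.rpow_logb hQ0 hQ.ne' ((wt_pos_iff hQ x l).2 hl), ← h3 l hl] at h4
      · have hl0 : wt Q x l = 0 :=
          le_antisymm (not_lt.1 fun h => hl ((wt_pos_iff hQ x l).1 h)) (wt_nonneg hQ x l)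
        -- With radius `1` and centre `1 - logb Q ε`, every `ρ l` exceeds `-logb Q ε`, that is, `Q ^
        -- (-ρ l) < ε`.
        obtain ⟨S, hS, h⟩ := nhd 1 (1 - Real.logb Q ε) one_pos
        filter_upwards [hS] with y hy
        obtain ⟨h0, ρ, -, h2, -, h4⟩ := h y hy
        rw [hl0, zero_div, Real.dist_0_eq_abs,
          abs_of_nonneg (div_nonneg (wt_nonneg hQ y l) h0.le)]
        refine (h4 l).trans_lt ?_
        rw [← Real.lt_logb_iff_rpow_lt hQ hε]
        have := (abs_lt.1 (h2 l hl)).1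
        linarith
    -- The weights have sum one, so they are recovered from their ratios.
    have hF : ∀ y : ABar ι, 0 < wt Q y i → wt Q y =
        fun l => (wt Q y l / wt Q y i) / ∑ k, wt Q y k / wt Q y i := by
      intro y hy
      funext l
      rw [← Finset.sum_div, sum_wt hQ, div_div_div_cancel_right₀ hy.ne', div_one]
    -- This neighbourhood serves only to keep the `i`-th weight positive.
    obtain ⟨S, hS, h⟩ := nhd 1 0 one_pos
    have hsum : ∑ k, wt Q x k / wt Q x i ≠ 0 := by
      rw [← Finset.sum_div, sum_wt hQ]
      exact (div_pos one_pos hwi).ne'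
    have hlim : Filter.Tendsto (fun y => fun l => (wt Q y l / wt Q y i) /
        ∑ k, wt Q y k / wt Q y i) (𝓝 x) (𝓝 (wt Q x)) := by
      rw [hF x hwi]
      rw [tendsto_pi_nhds] at hratio
      exact tendsto_pi_nhds.2 fun l => (hratio l).div
        (tendsto_finsetSum _ fun k _ => hratio k) hsum
    refine hlim.congr' ?_
    filter_upwards [hS] with y hy
    exact (hF y (h y hy).1).symm

theorem isInducing_wt : IsInducing (wt Q : ABar ι → ι → ℝ) := by
  classical
  refine ⟨le_antisymm (continuous_wt hQ).le_induced ?_⟩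
  refine le_generateFrom ?_
  rintro S (⟨U, hU, rfl⟩ | ⟨I, U, hI, hI', hU, -, rfl⟩)
  · refine isOpen_induced_iff.2 ⟨{t | (∀ i, 0 < t i) ∧ Apt.mk (fun i => -Real.logb Q (t i)) ∈ U},
      ?_, Set.ext fun x => (mem_incl_image_iff hQ U x).symm⟩
    refine isOpen_iff_mem_nhds.2 fun t ht => ?_
    filter_upwards [Filter.eventually_all.2 fun i =>
      (continuous_apply i).continuousAt.eventually (lt_mem_nhds (ht.1 i)),
      (continuousAt_aptMk_logb ht.1).eventually (hU.mem_nhds ht.2)] with s h1 h2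
    exact ⟨h1, h2⟩
  · refine isOpen_induced_iff.2 ⟨{t | ∃ a : ι → ℝ, (∀ i, 0 < a i) ∧
      Apt.mk (fun i => -Real.logb Q (a i)) ∈ U ∧ (∀ i ∈ I, t i = a i) ∧ ∀ i, t i ≤ a i},
      ?_, Set.ext fun x => (mem_Gam_iff hQ I U x).symm⟩
    refine isOpen_iff_mem_nhds.2 ?_
    rintro t ⟨a, ha, haU, haI, hle⟩
    -- A bound that varies continuously with `s`: it is forced on `I`, and elsewhere `a` is raised
    -- just enough to dominate `s`. At `s = t` it returns `a`, so it stays admissible near `t`.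
    set f : (ι → ℝ) → ι → ℝ := fun s i => if i ∈ I then s i else max (a i) (s i) with hf
    have hfc : Continuous f := by
      refine continuous_pi fun i => ?_
      by_cases hi : i ∈ I
      · simp only [hf, if_pos hi]
        exact continuous_apply i
      · simp only [hf, if_neg hi]
        exact continuous_const.max (continuous_apply i)
    have hft : f t = a := by
      funext i
      by_cases hi : i ∈ I
      · simp only [hf, if_pos hi, haI i hi]
      · simp only [hf, if_neg hi, max_eq_left (hle i)]
    have hc : ContinuousAt (fun s => Apt.mk fun i => -Real.logb Q (f s i)) t :=
      ContinuousAt.comp (g := fun a : ι → ℝ => Apt.mk fun i => -Real.logb Q (a i))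
        (by rw [hft]; exact continuousAt_aptMk_logb ha) hfc.continuousAt
    filter_upwards [Filter.eventually_all.2 fun i => ((continuous_apply i).comp
      hfc).continuousAt.eventually (lt_mem_nhds (show 0 < f t i by rw [hft]; exact ha i)),
      hc.eventually (hU.mem_nhds (by beta_reduce; rw [hft]; exact haU))] with s h1 h2
    refine ⟨f s, h1, h2, fun i hi => ?_, fun i => ?_⟩
    · simp only [hf, if_pos hi]
    · simp only [hf]
      split_ifs
      · exact le_rfl
      · exact le_max_right _ _

omit [Nonempty ι] in
theorem range_wt : Set.range (wt Q : ABar ι → ι → ℝ) = stdSimplex ℝ ι :=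
  Set.Subset.antisymm (Set.range_subset_iff.2 fun x => wt_mem_stdSimplex hQ x)
    fun _ ht => exists_wt_eq hQ ht

-- The topology of `Ā` does not depend on the base of the exponential; base `2` is as good as any.
omit hQ in
instance : CompactSpace (ABar ι) where
  isCompact_univ := by
    rw [(isInducing_wt (one_lt_two (α := ℝ))).isCompact_iff, Set.image_univ,
      range_wt one_lt_two]
    exact isCompact_stdSimplex ℝ ι

/-! ### Half-spaces and their closures in terms of weights. -/

theorem mem_halfspace_iff (i j : ι) (t : ℝ) (z : Apt ι) :
    -t ≤ root i j z ↔ wt Q (incl z) i ≤ Q ^ t * wt Q (incl z) j := by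
  have hQ0 : 0 < Q := one_pos.trans hQ
  have h : wt Q (incl z) j = Q ^ root i j z * wt Q (incl z) i := by
    rw [wt_incl hQ, wt_incl hQ, ← div_eq_mul_inv, inv_eq_one_div, div_eq_div_iff, one_mul,
      Finset.mul_sum]
    · refine Finset.sum_congr rfl fun k _ => ?_
      rw [← Real.rpow_add hQ0]
      obtain ⟨x, rfl⟩ := Apt.mk_surjective z
      simp only [root_mk]
      ring_nf
    · exact (Finset.sum_pos (fun j _ => Real.rpow_pos_of_pos hQ0 _) Finset.univ_nonempty).ne'
    · exact (Finset.sum_pos (fun j _ => Real.rpow_pos_of_pos hQ0 _) Finset.univ_nonempty).ne'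
  have hi := wt_incl_pos hQ z i
  rw [h, ← mul_assoc, ← Real.rpow_add hQ0, le_mul_iff_one_le_left hi]
  generalize root i j z = r
  rw [← Real.rpow_zero Q, Real.rpow_le_rpow_left_iff hQ]
  constructor <;> intro <;> linarith

theorem mem_closure_halfspace_iff {i j : ι} (hij : i ≠ j) (t : ℝ) (x : ABar ι) :
    x ∈ closure (incl '' {z | -t ≤ root i j z}) ↔ wt Q x i ≤ Q ^ t * wt Q x j := by
  classical
  have hQ0 : 0 < Q := one_pos.trans hQ
  constructor
  · intro hx
    have hcl : IsClosed {x : ABar ι | wt Q x i ≤ Q ^ t * wt Q x j} :=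
      isClosed_le ((continuous_apply i).comp (continuous_wt hQ))
        (continuous_const.mul ((continuous_apply j).comp (continuous_wt hQ)))
    refine closure_minimal ?_ hcl hx
    rintro _ ⟨z, hz, rfl⟩
    exact (mem_halfspace_iff hQ i j t z).1 hz
  · intro hx
    -- The normalisation of `e` is an interior point of the simplex on the bounding wall. Moving
    -- from `x` slightly towards it makes all weights positive and keeps the linear inequality.
    set e : ι → ℝ := fun k => if k = i then Q ^ t else 1 with he
    have hepos : ∀ k, 0 < e k := fun k => by
      simp only [he]
      split_ifs
      · exact Real.rpow_pos_of_pos hQ0 _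
      · exact one_pos
    have hei : e i = Q ^ t * e j := by simp [he, hij.symm]
    have hD : 0 < ∑ k, e k := Finset.sum_pos (fun k _ => hepos k) Finset.univ_nonempty
    set f : ℝ → ι → ℝ := fun ε k => (1 - ε) * wt Q x k + ε * (e k / ∑ k, e k) with hf
    have hfc : Continuous f := by
      refine continuous_pi fun k => ?_
      exact ((continuous_const.sub continuous_id).mul continuous_const).add
        (continuous_id.mul continuous_const)
    have hf0 : f 0 = wt Q x := by
      funext k
      simp [hf]
    rw [(isInducing_wt hQ).closure_eq_preimage_closure_image, Set.mem_preimage]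
    have hlim : Filter.Tendsto f (𝓝[>] 0) (𝓝 (wt Q x)) := by
      rw [← hf0]
      exact hfc.continuousAt.tendsto.mono_left nhdsWithin_le_nhds
    refine mem_closure_of_tendsto hlim ?_
    filter_upwards [Ioo_mem_nhdsGT (one_pos (α := ℝ))] with ε hε
    have hfpos : ∀ k, 0 < f ε k := fun k =>
      add_pos_of_nonneg_of_pos (mul_nonneg (by linarith [hε.2]) (wt_nonneg hQ x k))
        (mul_pos hε.1 (div_pos (hepos k) hD))
    have hfs : f ε ∈ stdSimplex ℝ ι := by
      refine ⟨fun k => (hfpos k).le, ?_⟩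
      simp only [hf]
      rw [Finset.sum_add_distrib, ← Finset.mul_sum, ← Finset.mul_sum, sum_wt hQ, ← Finset.sum_div,
        div_self hD.ne']
      ring
    obtain ⟨y, hy⟩ := exists_wt_eq hQ hfs
    obtain ⟨z, rfl⟩ : ∃ z, y = incl z := ⟨_, eq_incl_of_wt_pos hQ (by rw [hy]; exact hfpos)⟩
    refine ⟨_, ⟨z, (mem_halfspace_iff hQ i j t z).2 ?_, rfl⟩, hy⟩
    rw [hy]
    simp only [hf]
    rw [hei, mul_div_assoc, mul_add, mul_left_comm _ ε, mul_left_comm _ (1 - ε)]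
    gcongr
    linarith [hε.2]

end ApartmentTopology

/-! ### Stabilisers of the points of the apartment -/

section Stabiliser

variable {K : Type*} [NontriviallyNormedField K] [IsUltrametricDist K] [LocallyCompactSpace K]
  {V : Type*} [AddCommGroup V] [Module K V] {ι : Type*} [Fintype ι]
  (b : Module.Basis ι K V)

variable (K) in
theorem one_lt_q_real : (1 : ℝ) < q K := by exact_mod_cast one_lt_q K

theorem norm_eq_rpow_neg_val {ω : K} (hω : ω ≠ 0) : ‖ω‖ = (q K : ℝ) ^ (-val ω) := by
  rw [val, neg_neg, Real.rpow_logb (one_pos.trans (one_lt_q_real K)) (one_lt_q_real K).ne'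
    (norm_pos_iff.2 hω)]

-- The condition on `t` is closed and inherited by larger `t`, so passing to the limit from above
-- turns the infimum into the inequality at `s`. The values `±∞` of `fRoot` are covered as well.
variable (K) in
theorem fRoot_le_iff [Nonempty ι] (x : ABar ι) {i j : ι} (hij : i ≠ j) (s : ℝ) :
    fRoot x i j ≤ s ↔ wt (q K) x i ≤ (q K : ℝ) ^ s * wt (q K) x j := by
  have hQ := one_lt_q_real K
  simp only [fRoot, mem_closure_halfspace_iff hQ hij]
  constructor
  · intro h
    have h1 : ∀ r : ℝ, s < r → wt (q K) x i ≤ (q K : ℝ) ^ r * wt (q K) x j := by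
      intro r hr
      obtain ⟨_, ⟨t, ht, rfl⟩, htr⟩ := sInf_lt_iff.1 (h.trans_lt (EReal.coe_lt_coe hr))
      refine (show wt (q K) x i ≤ _ from ht).trans (mul_le_mul_of_nonneg_right ?_
        (wt_nonneg hQ x j))
      exact Real.rpow_le_rpow_of_exponent_le hQ.le (EReal.coe_lt_coe_iff.1 htr).le
    have hc : Continuous fun r : ℝ => (q K : ℝ) ^ r * wt (q K) x j :=
      (continuous_const.rpow continuous_id fun _ => Or.inl (one_pos.trans hQ).ne').mul
        continuous_const
    refine ge_of_tendsto (hc.continuousAt.tendsto.mono_left nhdsWithin_le_nhds :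
      Filter.Tendsto _ (𝓝[>] s) _) ?_
    filter_upwards [self_mem_nhdsWithin] with r hr using h1 r hr
  · intro h
    exact sInf_le ⟨s, h, rfl⟩

theorem fRoot_le_valE_iff [Nonempty ι] (x : ABar ι) {i j : ι} (hij : i ≠ j) (ω : K) :
    fRoot x i j ≤ valE ω ↔ ‖ω‖ * wt (q K) x i ≤ wt (q K) x j := by
  have hQ := one_lt_q_real K
  by_cases hω : ω = 0
  · simp [valE, hω, wt_nonneg hQ x j]
  · have hp : 0 < (q K : ℝ) ^ (val ω) := Real.rpow_pos_of_pos (one_pos.trans hQ) _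
    rw [valE, if_neg hω, fRoot_le_iff K x hij, norm_eq_rpow_neg_val hω,
      Real.rpow_neg (one_pos.trans hQ).le, inv_mul_le_iff₀ hp]

theorem Ux_eq_map [Nonempty ι] (x : ABar ι) :
    Ux b x = (rootSubgroup b (wt (q K) x)).map PGL.mk := by
  rw [rootSubgroup, MonoidHom.map_closure, Ux]
  congr 1
  ext g
  constructor
  · rintro ⟨i, j, hij, ω, h, rfl⟩
    exact ⟨_, ⟨i, j, hij, ω, (fRoot_le_valE_iff x hij ω).1 h, rfl⟩, rfl⟩
  · rintro ⟨_, ⟨i, j, hij, ω, h, rfl⟩, rfl⟩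
    exact ⟨i, j, hij, ω, (fRoot_le_valE_iff x hij ω).2 h, rfl⟩

variable (K) in
/-- The normalised seminorm representing `φ(x)`. -/
def wtSem (x : ABar ι) : NSeminorm K V :=
  semW b (wt (q K) x) (wt_nonneg (one_lt_q_real K) x) (exists_wt_ne_zero (one_lt_q_real K) x)

theorem phi_eq (x : ABar ι) : (phi b x : SemClass K V) = SemClass.mk (wtSem K b x) := by
  have hQ := one_lt_q_real K
  obtain ⟨I, hI, p⟩ := x
  obtain ⟨y, rfl⟩ := Apt.mk_surjective p
  rw [phi_mk]
  have hD := sum_rawWt_pos (one_pos.trans hQ) I y hI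
  refine SemClass.sound ⟨_, hD, fun v => ?_⟩
  rw [wtSem, semW_apply, Real.mul_iSup_of_nonneg hD.le]
  have h : ∀ i, (∑ j, rawWt (q K : ℝ) I y j) * (‖b.repr v i‖ * wt (q K : ℝ) ⟨I, hI, Apt.mk y⟩ i)
      = ‖b.repr v i‖ * rawWt (q K) I y i := by
    intro i
    rw [wt_mk hQ]
    field_simp
  simp only [h]
  have : Nonempty I := hI.to_subtype
  have : Nonempty ι := ⟨hI.choose⟩
  refine le_antisymm (ciSup_le fun i => ?_) (ciSup_le fun i => ?_)
  · rw [← rawWt_of_mem I y i.2]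
    exact le_iSup_weight b (rawWt (q K) I y) v i
  · by_cases hi : i ∈ I
    · rw [rawWt_of_mem I y hi]
      exact semOf_term_le b I y v ⟨i, hi⟩
    · rw [rawWt_of_notMem I y hi, mul_zero]
      exact (semOf b I hI y).nonneg v

theorem phi_injective : Function.Injective (phi b : ABar ι → SemClass K V) := by
  intro x y h
  have hQ := one_lt_q_real K
  rw [phi_eq, phi_eq] at h
  obtain ⟨c, -, hc⟩ := (mk_semW_eq_iff b _ _ _ _).1 h
  have h1 : c = 1 := by
    have := sum_wt hQ x
    simp only [hc] at this
    rwa [← Finset.mul_sum, sum_wt hQ, mul_one] at this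
  refine wt_injective hQ (funext fun i => ?_)
  rw [hc, h1, one_mul]

omit [IsUltrametricDist K] [LocallyCompactSpace K] [Fintype ι] in
theorem repr_monomial_inv_smul (d : ι → Kˣ) (w : Equiv.Perm ι) (v : V) (i : ι) :
    b.repr ((diagGL b d * permGL b w)⁻¹ • v) i = (d (w i) : K)⁻¹ * b.repr v (w i) := by
  have : (b.coord i) ∘ₗ (((diagGL b d * permGL b w)⁻¹ : LinearMap.GeneralLinearGroup K V) :
      V →ₗ[K] V) = ((d (w i) : K)⁻¹) • b.coord (w i) := b.ext fun l => by
    obtain ⟨l, rfl⟩ := w.surjective l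
    change b.repr ((diagGL b d * permGL b w)⁻¹ • b (w l)) i = (d (w i) : K)⁻¹ * b.repr _ _
    rw [monomial_inv_smul_basis, map_smul, Module.Basis.repr_self, Module.Basis.repr_self,
      Finsupp.smul_apply, smul_eq_mul]
    by_cases h : i = l
    · rw [h, Finsupp.single_eq_same, Finsupp.single_eq_same]
    · rw [Finsupp.single_eq_of_ne h, Finsupp.single_eq_of_ne (w.injective.ne h), mul_zero,
        mul_zero]
  exact LinearMap.congr_fun this v

theorem phi_nu (n : N b) (x : ABar ι) : phi b (nu b n x) = (n : PGL K V) • phi b x := by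
  have hQ := one_lt_q_real K
  obtain ⟨d, w, h⟩ := exists_monomial b n
  rw [nu_eq b h, h]
  obtain ⟨I, hI, p⟩ := x
  obtain ⟨y, rfl⟩ := Apt.mk_surjective p
  refine congrArg SemClass.mk (NSeminorm.ext (funext fun v => ?_) :
    semOf b (I.map w.toEmbedding) hI.map (fun i => -val (d i : K) +
      y ⟨w.symm i, Finset.mem_map_equiv.1 i.2⟩) = (diagGL b d * permGL b w) • semOf b I hI y)
  rw [NSeminorm.gl_smul_apply]
  refine (Function.Surjective.iSup_congr (fun i : I => (⟨w i, Finset.mem_map_equiv.2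
    (by simp)⟩ : I.map w.toEmbedding)) ?_ fun i => ?_).symm
  · rintro ⟨j, hj⟩
    exact ⟨⟨w.symm j, Finset.mem_map_equiv.1 hj⟩, Subtype.ext (w.apply_symm_apply j)⟩
  · have h1 : y ⟨w.symm (w i), by simp⟩ = y i := congrArg y (Subtype.ext (w.symm_apply_apply i))
    rw [repr_monomial_inv_smul, norm_mul, norm_inv]
    change _ * (q K : ℝ) ^ (-(-val (d (w i) : K) + y ⟨w.symm (w i), _⟩)) = _
    rw [h1, neg_add, Real.rpow_add (one_pos.trans hQ), neg_neg,
      norm_eq_rpow_neg_val (Units.ne_zero (d (w i))), ← Real.rpow_neg (one_pos.trans hQ).le, neg_neg]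
    ring

/-- Evaluating the equivariance of `φ` at basis vectors gives the new weights without computing in
`Ā`; `c` accounts for the normalisation. -/
theorem wt_nu {n : N b} {d : ι → Kˣ} {w : Equiv.Perm ι}
    (h : (n : PGL K V) = PGL.mk (diagGL b d * permGL b w)) (x : ABar ι) :
    ∃ c : ℝ, 0 < c ∧
      ∀ i, wt (q K) (nu b n x) (w i) = c * (‖(d (w i) : K)‖⁻¹ * wt (q K) x i) := by
  have h1 := phi_nu b n x
  rw [phi_eq, phi_eq, h, PGL.mk_smul, SemClass.gl_smul_mk] at h1
  obtain ⟨c, hc, h1⟩ := Quotient.exact (s := nsSetoid K V) h1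
  refine ⟨c, hc, fun i => ?_⟩
  have h2 := h1 (b (w i))
  rwa [NSeminorm.gl_smul_apply, monomial_inv_smul_basis, NSeminorm.smul, wtSem, semW_basis, wtSem,
    semW_basis, norm_inv] at h2

theorem nu_eq_of_smul_phi {n : N b} {x y : ABar ι} (h : (n : PGL K V) • phi b x = phi b y) :
    nu b n x = y :=
  phi_injective b (by rw [phi_nu, h])

variable [Nonempty ι]

theorem smul_phi_of_mem_Ux {x : ABar ι} {g : PGL K V} (hg : g ∈ Ux b x) :
    g • phi b x = phi b x := by
  rw [Ux_eq_map] at hg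
  obtain ⟨u, hu, rfl⟩ := hg
  rw [phi_eq, PGL.mk_smul, SemClass.gl_smul_mk, wtSem, rootSubgroup_smul_semW b _ _ hu]

theorem conj_mem_Ux {n : N b} {x : ABar ι} {g : PGL K V} (hg : g ∈ Ux b x) :
    (n : PGL K V) * g * (n : PGL K V)⁻¹ ∈ Ux b (nu b n x) := by
  rw [Ux_eq_map] at hg ⊢
  obtain ⟨u, hu, rfl⟩ := hg
  obtain ⟨d, w, h⟩ := exists_monomial b n
  obtain ⟨c, hc, hw⟩ := wt_nu b h x
  rw [h, ← map_inv, ← map_mul, ← map_mul]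
  exact Subgroup.mem_map_of_mem _ (monomial_conj_mem_rootSubgroup b d w hc hw hu)

/-- The weighted elimination, with the weights of `y` on rows and those of `x` on columns. -/
theorem exists_eq_Ux_mul_N_mul_Ux (g : PGL K V) (x y : ABar ι) :
    ∃ u ∈ Ux b y, ∃ n : N b, ∃ u' ∈ Ux b x, g = u * n * u' := by
  have hQ := one_lt_q_real K
  obtain ⟨g, rfl⟩ := PGL.mk_surjective g
  obtain ⟨u, hu, d, w, u', hu', h⟩ := exists_bruhat (b := b) (wt_nonneg hQ y) (wt_nonneg hQ x) g
  simp only [Ux_eq_map]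
  refine ⟨_, Subgroup.mem_map_of_mem _ hu, ⟨_, mk_monomial_mem_N b d w⟩, _,
    Subgroup.mem_map_of_mem _ hu', ?_⟩
  rw [h, map_mul, map_mul]

/-- If `g = u n u'` fixes `φ(x)`, with `u` and `u'` in `U_x`, then so does `n`, and `ν(n) x = x` by
injectivity of `φ`. Now `n` normalises `U_x`, so `u'` can be moved to the left of `n`. -/
theorem mem_Px_iff (x : ABar ι) (g : PGL K V) : g ∈ Px b x ↔ g • phi b x = phi b x := by
  constructor
  · rintro ⟨u, hu, _, ⟨n, hn, rfl⟩, rfl⟩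
    change (u * (n : PGL K V)) • _ = _
    rw [mul_smul, ← phi_nu, hn]
    exact smul_phi_of_mem_Ux b hu
  · intro hg
    obtain ⟨u, hu, n, u', hu', rfl⟩ := exists_eq_Ux_mul_N_mul_Ux b g x x
    rw [mul_smul, mul_smul, smul_phi_of_mem_Ux b hu', ← eq_inv_smul_iff,
      smul_phi_of_mem_Ux b (inv_mem hu)] at hg
    have hn := nu_eq_of_smul_phi b hg
    have h := conj_mem_Ux b (n := n) hu'
    rw [hn] at h
    refine ⟨_, mul_mem hu h, _, ⟨n, hn, rfl⟩, ?_⟩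
    group

/-- The element `n` required by the relation is the `N`-part of `h⁻¹ g` in `U_y N U_x`: the outer
factors fix `φ(y)` and `φ(x)`, so `n` carries `x` to `y`. -/
theorem BRel_iff (p p' : PGL K V × ABar ι) :
    BRel b p p' ↔ p.1 • phi b p.2 = p'.1 • phi b p'.2 := by
  simp only [BRel, mem_Px_iff]
  constructor
  · rintro ⟨n, hn, h⟩
    rw [mul_smul, mul_smul, inv_smul_eq_iff, ← phi_nu, hn] at h
    exact h.symm
  · intro h
    obtain ⟨u, hu, n, u', hu', hg⟩ := exists_eq_Ux_mul_N_mul_Ux b (p'.1⁻¹ * p.1) p.2 p'.2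
    have h1 : (p'.1⁻¹ * p.1) • phi b p.2 = phi b p'.2 := by rw [mul_smul, h, inv_smul_smul]
    rw [hg, mul_smul, mul_smul, smul_phi_of_mem_Ux b hu', ← eq_inv_smul_iff,
      smul_phi_of_mem_Ux b (inv_mem hu)] at h1
    have hn := nu_eq_of_smul_phi b h1
    refine ⟨n, hn, ?_⟩
    rw [mul_smul, mul_smul, h1, ← h, inv_smul_smul]

theorem BRel_equivalence : Equivalence (BRel b) where
  refl p := (BRel_iff b p p).2 rfl
  symm h := (BRel_iff b _ _).2 ((BRel_iff b _ _).1 h).symm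
  trans h h' := (BRel_iff b _ _).2 (((BRel_iff b _ _).1 h).trans ((BRel_iff b _ _).1 h'))

omit [LocallyCompactSpace K] [Fintype ι] [Nonempty ι] in
theorem nuT_one : nuT (1 : ι → Kˣ) = 0 :=
  (Submodule.Quotient.mk_eq_zero _).2 (by
    simp only [Pi.one_apply, Units.val_one, val, norm_one, Real.logb_one, neg_zero]
    exact zero_mem _)

omit [LocallyCompactSpace K] in
theorem Ux_subset_U0hat : (Ux b (incl 0) : Set (PGL K V)) ⊆ U0hat b := fun u hu =>
  ⟨u, hu, 1, ⟨1, nuT_one, ((PGL.mk.comp (diagHom b)).map_one).symm⟩, mul_one u⟩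

theorem exists_eq_U0hat_mul_N_mul_Px (g : PGL K V) (x : ABar ι) :
    ∃ (v : U0hat b) (n : N b) (h : PGL K V), h ∈ Px b x ∧ g = (v : PGL K V) * n * h := by
  obtain ⟨u, hu, n, u', hu', h⟩ := exists_eq_Ux_mul_N_mul_Ux b g x (incl 0)
  exact ⟨⟨u, Ux_subset_U0hat b hu⟩, n, u', (mem_Px_iff b x u').2 (smul_phi_of_mem_Ux b hu'), h⟩

end Stabiliser

/-! ### Ultrametric estimates for finite sums. -/

section NSeminorm

variable {K V ι : Type*} [NontriviallyNormedField K] [AddCommGroup V] [Module K V]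

theorem NSeminorm.map_zero (γ : NSeminorm K V) : γ.toFun 0 = 0 := by
  have := γ.smul 0 0
  rwa [zero_smul, norm_zero, zero_mul] at this

theorem NSeminorm.sum_le (γ : NSeminorm K V) {C : ℝ} (hC : 0 ≤ C) (f : ι → V) (s : Finset ι)
    (h : ∀ i ∈ s, γ.toFun (f i) ≤ C) : γ.toFun (∑ i ∈ s, f i) ≤ C :=
  Finset.sum_induction f (fun v => γ.toFun v ≤ C)
    (fun v w hv hw => (γ.add_le v w).trans (max_le hv hw)) (γ.map_zero.trans_le hC) h

theorem NSeminorm.sum_lt (γ : NSeminorm K V) {C : ℝ} (hC : 0 < C) (f : ι → V) (s : Finset ι)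
    (h : ∀ i ∈ s, γ.toFun (f i) < C) : γ.toFun (∑ i ∈ s, f i) < C :=
  Finset.sum_induction f (fun v => γ.toFun v < C)
    (fun v w hv hw => (γ.add_le v w).trans_lt (max_lt hv hw)) (γ.map_zero.trans_lt hC) h

theorem NSeminorm.le_of_basis (γ : NSeminorm K V) [Fintype ι] (b : Module.Basis ι K V) (v : V) {C : ℝ}
    (hC : 0 ≤ C) (h : ∀ i, ‖b.repr v i‖ * γ.toFun (b i) ≤ C) : γ.toFun v ≤ C := by
  rw [← b.sum_repr v]
  refine γ.sum_le hC _ _ fun i _ => ?_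
  rw [γ.smul]
  exact h i

end NSeminorm

/-! ### The stabiliser of the origin -/

section Origin

variable {Q : ℝ} {ι : Type*} [Fintype ι] [Nonempty ι]

theorem wt_incl_zero (hQ : 1 < Q) (i : ι) : wt Q (incl 0) i = (Fintype.card ι : ℝ)⁻¹ := by
  rw [wt_incl hQ]
  simp

theorem card_inv_pos : (0 : ℝ) < (Fintype.card ι : ℝ)⁻¹ :=
  inv_pos.2 (Nat.cast_pos.2 Fintype.card_pos)

variable {K : Type*} [NontriviallyNormedField K] [IsUltrametricDist K] [LocallyCompactSpace K]
  {V : Type*} [AddCommGroup V] [Module K V] (b : Module.Basis ι K V)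

theorem wtSem_incl_zero_basis (i : ι) :
    (wtSem K b (incl 0)).toFun (b i) = (Fintype.card ι : ℝ)⁻¹ := by
  rw [wtSem, semW_basis, wt_incl_zero (one_lt_q_real K)]

theorem wtSem_incl_zero_le_iff (v : V) (C : ℝ) :
    (wtSem K b (incl 0)).toFun v ≤ (Fintype.card ι : ℝ)⁻¹ * C ↔ ∀ i, ‖b.repr v i‖ ≤ C := by
  rw [wtSem, semW_apply, ciSup_le_iff (Set.finite_range _).bddAbove]
  refine forall_congr' fun i => ?_
  rw [wt_incl_zero (one_lt_q_real K), mul_comm, mul_le_mul_iff_right₀ card_inv_pos]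

/-- The maximal compact subgroup `GL_n(R)` of `GL(V)`: the stabiliser of the seminorm attached to
the origin. -/
def intGL : Subgroup (LinearMap.GeneralLinearGroup K V) :=
  MulAction.stabilizer _ (wtSem K b (incl 0))

theorem rootSubgroup_le_intGL : rootSubgroup b (wt (q K) (incl 0)) ≤ intGL b := fun _ hu =>
  rootSubgroup_smul_semW b _ _ hu

/-- At the origin all weights are equal, so preserving the seminorm means that `g` and `g⁻¹` have
integral matrices. Compactness is read off from this form. -/
theorem mem_intGL_iff (g : LinearMap.GeneralLinearGroup K V) :
    g ∈ intGL b ↔ (∀ i j, ‖b.repr (g • b j) i‖ ≤ 1) ∧ ∀ i j, ‖b.repr (g⁻¹ • b j) i‖ ≤ 1 := by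
  have h1 : ∀ g ∈ intGL b, ∀ i j, ‖b.repr (g • b j) i‖ ≤ 1 := by
    intro g hg i j
    refine (wtSem_incl_zero_le_iff b _ _).1 ?_ i
    have h := congrFun (congrArg NSeminorm.toFun (MulAction.mem_stabilizer_iff.1 hg)) (g • b j)
    rw [NSeminorm.gl_smul_apply, inv_smul_smul] at h
    rw [← h, wtSem_incl_zero_basis, mul_one]
  have h2 : ∀ g : LinearMap.GeneralLinearGroup K V, (∀ i j, ‖b.repr (g • b j) i‖ ≤ 1) →
      ∀ v, (wtSem K b (incl 0)).toFun (g • v) ≤ (wtSem K b (incl 0)).toFun v := by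
    intro g hg v
    have hle := (wtSem K b (incl 0)).nonneg v
    have hv : g • v = ∑ i, b.repr v i • g • b i := by
      conv_lhs => rw [← b.sum_repr v, Finset.smul_sum]
      exact Finset.sum_congr rfl fun i _ => smul_comm _ _ _
    rw [hv]
    refine NSeminorm.sum_le _ hle _ _ fun i _ => ?_
    rw [NSeminorm.smul]
    refine (mul_le_mul_of_nonneg_left (((wtSem_incl_zero_le_iff b _ _).2 fun k => hg k i))
      (norm_nonneg _)).trans ?_
    rw [mul_one, ← wt_incl_zero (one_lt_q_real K) i]
    exact le_iSup_weight b _ v i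
  refine ⟨fun hg => ⟨h1 g hg, h1 g⁻¹ (inv_mem hg)⟩, fun ⟨hg, hg'⟩ => ?_⟩
  refine MulAction.mem_stabilizer_iff.2 (NSeminorm.ext (funext fun v => le_antisymm ?_ ?_))
  · exact h2 g⁻¹ hg' v
  · have := h2 g hg (g⁻¹ • v)
    rwa [smul_inv_smul] at this

theorem monomial_mem_intGL_iff (d : ι → Kˣ) (w : Equiv.Perm ι) :
    diagGL b d * permGL b w ∈ intGL b ↔ ∀ i, ‖(d i : K)‖ = 1 := by
  constructor
  · intro h i
    obtain ⟨i, rfl⟩ := w.surjective i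
    have h := congrFun (congrArg NSeminorm.toFun (MulAction.mem_stabilizer_iff.1 h)) (b (w i))
    rw [NSeminorm.gl_smul_apply, monomial_inv_smul_basis, NSeminorm.smul, wtSem_incl_zero_basis,
      wtSem_incl_zero_basis, mul_eq_right₀ card_inv_pos.ne', norm_inv, inv_eq_one] at h
    exact h
  · intro h
    refine (mem_intGL_iff b _).2 ⟨fun i j => ?_, fun i j => ?_⟩
    · classical
      rw [monomial_smul_basis, map_smul, Module.Basis.repr_self, Finsupp.smul_apply, norm_smul, h,
        one_mul, Finsupp.single_apply]
      split_ifs <;> simp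
    · classical
      rw [repr_monomial_inv_smul, norm_mul, norm_inv, h, inv_one, one_mul,
        Module.Basis.repr_self, Finsupp.single_apply]
      split_ifs <;> simp

theorem conj_mem_rootSubgroup_origin (d : ι → Kˣ) (w : Equiv.Perm ι) (hd : ∀ i, ‖(d i : K)‖ = 1)
    {u : LinearMap.GeneralLinearGroup K V} (hu : u ∈ rootSubgroup b (wt (q K) (incl 0))) :
    (diagGL b d * permGL b w) * u * (diagGL b d * permGL b w)⁻¹ ∈
      rootSubgroup b (wt (q K) (incl 0)) :=
  monomial_conj_mem_rootSubgroup b d w one_pos (fun i => by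
    simp only [wt_incl_zero (one_lt_q_real K), hd, inv_one, one_mul]) hu

-- The classical `SL_2` identity; it shows that permutations contribute nothing to `GL_n(R)` beyond
-- unipotents and unit diagonal matrices.
omit [IsUltrametricDist K] [LocallyCompactSpace K] [Fintype ι] [Nonempty ι] in
theorem permGL_swap [DecidableEq ι] {i j : ι} (hij : i ≠ j) :
    permGL b (Equiv.swap i j) =
      rootGL b hij 1 * rootGL b hij.symm (-1) * rootGL b hij 1 *
        diagGL b (Function.update 1 i (-1)) := by
  refine gl_ext b fun l => ?_
  have h : ∀ k l, b.coord k (b l) = if l = k then 1 else 0 := fun k l => by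
    rw [Module.Basis.coord_apply, Module.Basis.repr_self, Finsupp.single_apply]
  rw [permGL_smul_basis, mul_smul, mul_smul, mul_smul, diagGL_smul_basis]
  simp only [rootGL_smul, map_add, map_smul, h, smul_eq_mul]
  by_cases hi : l = i
  · subst hi
    simp [hij]
  · by_cases hj : l = j
    · subst hj
      simp [hij, hij.symm]
    · simp [hi, hj, Equiv.swap_apply_of_ne_of_ne hi hj]

theorem exists_permGL_eq (w : Equiv.Perm ι) :
    ∃ u ∈ rootSubgroup b (wt (q K) (incl 0)), ∃ e : ι → Kˣ, (∀ i, ‖(e i : K)‖ = 1) ∧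
      permGL b w = u * diagGL b e := by
  classical
  have hQ := one_lt_q_real K
  induction w using Equiv.Perm.swap_induction_on with
  | one =>
    refine ⟨1, one_mem _, 1, fun i => by simp, ?_⟩
    rw [permGL_one, one_mul]
    exact ((diagHom b).map_one).symm
  | swap_mul w i j hij ih =>
    obtain ⟨u, hu, e, he, h⟩ := ih
    have he' : ∀ k, ‖((Function.update (1 : ι → Kˣ) i (-1) k : Kˣ) : K)‖ = 1 := by
      intro k
      by_cases hk : k = i
      · subst hk
        simp
      · simp [Function.update_of_ne hk]
    have hroot : ∀ {i j : ι} (hij : i ≠ j) (ω : K), ‖ω‖ = 1 →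
        rootGL b hij ω ∈ rootSubgroup b (wt (q K) (incl 0)) := fun hij ω hω =>
      rootGL_mem_rootSubgroup hij (by simp [wt_incl_zero hQ, hω])
    have h1 := conj_mem_rootSubgroup_origin b (Function.update (1 : ι → Kˣ) i (-1)) (1 : Equiv.Perm ι) he' hu
    rw [permGL_one, mul_one] at h1
    refine ⟨_, mul_mem (mul_mem (mul_mem (hroot hij 1 norm_one) (hroot hij.symm (-1) (by simp)))
      (hroot hij 1 norm_one)) h1, Function.update (1 : ι → Kˣ) i (-1) * e, fun k => ?_, ?_⟩
    · rw [Pi.mul_apply, Units.val_mul, norm_mul, he', he, one_mul]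
    · have h2 : diagGL b (Function.update (1 : ι → Kˣ) i (-1) * e) = _ := (diagHom b).map_mul _ _
      rw [h2, permGL_mul, h, permGL_swap b hij]
      simp only [diagHom, MonoidHom.coe_mk, OneHom.coe_mk]
      group

theorem U0hat_eq_image : U0hat b = PGL.mk '' (intGL b : Set (LinearMap.GeneralLinearGroup K V)) := by
  have hQ := one_lt_q_real K
  ext g
  constructor
  · rintro ⟨u, hu, _, ⟨d, hd, rfl⟩, rfl⟩
    rw [Ux_eq_map] at hu
    obtain ⟨u, hu, rfl⟩ := hu
    have i0 : ι := Classical.arbitrary ι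
    obtain ⟨c, hc⟩ := Submodule.mem_span_singleton.1 ((Submodule.Quotient.mk_eq_zero _).1 hd)
    have hd' : ∀ i, ‖(d i : K)‖ = (q K : ℝ) ^ c := fun i => by
      rw [norm_eq_rpow_neg_val (Units.ne_zero _), ← congrFun hc i]
      simp
    -- `ν(t) = 0` forces all `d i` to have the same absolute value; dividing by the scalar `d i0`
    -- gives units and the same class in `PGL`.
    refine ⟨u * diagGL b (fun i => (d i0)⁻¹ * d i), mul_mem (rootSubgroup_le_intGL b hu) ?_, ?_⟩
    · rw [← mul_one (diagGL b _), ← permGL_one b, monomial_mem_intGL_iff]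
      intro i
      rw [Units.val_mul, norm_mul, Units.val_inv_eq_inv_val, norm_inv, hd', hd']
      exact inv_mul_cancel₀ (Real.rpow_pos_of_pos (one_pos.trans hQ) _).ne'
    · rw [map_mul]
      refine congrArg (PGL.mk u * ·) (PGL.mk_eq_mk.2 ⟨d i0, fun v => ?_⟩)
      rw [← scalarHom_smul, ← mul_smul]
      congr 1
      refine gl_ext b fun i => ?_
      rw [mul_smul, diagGL_smul_basis, diagGL_smul_basis, scalarHom_smul, smul_smul, Units.val_mul,
        ← mul_assoc, Units.mul_inv, one_mul]
  · rintro ⟨g, hg, rfl⟩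
    obtain ⟨u, hu, d, w, u', hu', rfl⟩ := exists_bruhat (b := b) (wt_nonneg hQ (incl 0))
      (wt_nonneg hQ (incl 0)) g
    have hd : ∀ i, ‖(d i : K)‖ = 1 := by
      rw [← monomial_mem_intGL_iff b d w]
      have := mul_mem (mul_mem (inv_mem (rootSubgroup_le_intGL b hu)) hg)
        (inv_mem (rootSubgroup_le_intGL b hu'))
      convert! this using 1
      group
    obtain ⟨u1, hu1, e, he, hw⟩ := exists_permGL_eq b w
    have h1 := conj_mem_rootSubgroup_origin b d w hd hu'
    have h2 := conj_mem_rootSubgroup_origin b d 1 hd hu1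
    rw [permGL_one, mul_one] at h2
    have h3 : diagGL b (d * e) = diagGL b d * diagGL b e := (diagHom b).map_mul d e
    -- With `m = d w` and `w = u1 e`, this is `u m u' = u (m u' m⁻¹) (d u1 d⁻¹) (d e)`: the first
    -- three factors lie in `U_0`, the last in `Z`.
    refine ⟨PGL.mk (u * ((diagGL b d * permGL b w) * u' * (diagGL b d * permGL b w)⁻¹) *
      (diagGL b d * u1 * (diagGL b d)⁻¹)), ?_, PGL.mk (diagGL b (d * e)), ⟨d * e, ?_, rfl⟩, ?_⟩
    · rw [Ux_eq_map]
      exact Subgroup.mem_map_of_mem _ (mul_mem (mul_mem hu h1) h2)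
    · refine (Submodule.Quotient.mk_eq_zero _).2 ?_
      convert! Submodule.zero_mem _ using 1
      funext i
      simp [val, hd, he]
    · change PGL.mk _ * PGL.mk _ = _
      rw [← map_mul, h3]
      congr 1
      have h4 : diagGL b d * permGL b w = diagGL b d * u1 * diagGL b e := by rw [hw, mul_assoc]
      calc _ = u * ((diagGL b d * permGL b w) * u' * (diagGL b d * permGL b w)⁻¹) *
            (diagGL b d * u1 * diagGL b e) := by group
        _ = _ := by rw [← h4]; group

end Origin

/-! ### The topologies of `GL(V)` and `PGL(V)` -/

section Topologies

variable (K V : Type*) [NontriviallyNormedField K] [AddCommGroup V] [Module K V]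

/-- The canonical topology of `End(V)`. -/
abbrev endTopology : TopologicalSpace (Module.End K V) := moduleTopology K (Module.End K V)

attribute [local instance] endTopology

instance isModuleTopology_end : IsModuleTopology K (Module.End K V) := ⟨rfl⟩

variable {K V}
variable {ι : Type*} (b : Module.Basis ι K V)

theorem continuous_repr_smul (v : V) (i : ι) :
    Continuous fun g : LinearMap.GeneralLinearGroup K V => b.repr (g • v) i := by
  have h : Continuous (b.coord i ∘ₗ LinearMap.applyₗ v : Module.End K V →ₗ[K] K) :=
    IsModuleTopology.continuous_of_linearMap _
  exact h.comp Units.continuous_val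

theorem continuous_repr_inv_smul (v : V) (i : ι) :
    Continuous fun g : LinearMap.GeneralLinearGroup K V => b.repr (g⁻¹ • v) i := by
  have h : Continuous (b.coord i ∘ₗ LinearMap.applyₗ v : Module.End K V →ₗ[K] K) :=
    IsModuleTopology.continuous_of_linearMap _
  exact h.comp Units.continuous_coe_inv

variable [Fintype ι]

include b in
theorem isTopologicalRing_end : IsTopologicalRing (Module.End K V) := by
  have : Module.Finite K V := Module.Finite.of_basis b
  exact IsModuleTopology.isTopologicalRing K _

theorem continuous_mk : Continuous (PGL.mk : LinearMap.GeneralLinearGroup K V → PGL K V) :=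
  continuous_quotient_mk'

include b in
theorem isOpenQuotientMap_mk :
    IsOpenQuotientMap (PGL.mk : LinearMap.GeneralLinearGroup K V → PGL K V) := by
  have := isTopologicalRing_end b
  exact QuotientGroup.isOpenQuotientMap_mk

/-- The linear equivalence of `End(V)` with matrices is a homeomorphism. -/
def endHomeomorph [DecidableEq ι] : Module.End K V ≃ₜ Matrix ι ι K where
  toEquiv := (LinearMap.toMatrix b b).toEquiv
  continuous_toFun := IsModuleTopology.continuous_of_linearMap
    (LinearMap.toMatrix b b : Module.End K V →ₗ[K] Matrix ι ι K)
  continuous_invFun := by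
    have := isTopologicalRing_end b
    have : IsModuleTopology K (Matrix ι ι K) :=
      inferInstanceAs (IsModuleTopology K (ι → ι → K))
    have : ContinuousAdd (Module.End K V) := inferInstance
    exact IsModuleTopology.continuous_of_linearMap
      ((LinearMap.toMatrix b b).symm : Matrix ι ι K →ₗ[K] Module.End K V)

theorem isInducing_matrix [DecidableEq ι] :
    IsInducing fun g : LinearMap.GeneralLinearGroup K V =>
      (LinearMap.toMatrix b b (g : Module.End K V),
        LinearMap.toMatrix b b ((g⁻¹ : LinearMap.GeneralLinearGroup K V) : Module.End K V)) :=
  (((endHomeomorph b).prodCongr (MulOpposite.opHomeomorph.symm.trans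
    (endHomeomorph b))).isInducing).comp Units.isInducing_embedProduct

variable [IsUltrametricDist K] [LocallyCompactSpace K] [Nonempty ι]

/-- Under `g ↦ (g, g⁻¹)` the group becomes the closed set of mutually inverse pairs in a product of
closed unit balls of the proper field `K`. -/
theorem isCompact_intGL : IsCompact (intGL b : Set (LinearMap.GeneralLinearGroup K V)) := by
  classical
  have : ProperSpace K := ProperSpace.of_nontriviallyNormedField_of_weaklyLocallyCompactSpace K
  rw [(isInducing_matrix b).isCompact_iff]
  have hB : IsCompact {A : Matrix ι ι K | ∀ i j, A i j ∈ Metric.closedBall (0 : K) 1} := by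
    have := isCompact_univ_pi fun _ : ι => isCompact_univ_pi fun _ : ι =>
      isCompact_closedBall (0 : K) 1
    convert! this using 1
    exact Set.ext fun A => ⟨fun h i _ j _ => h i j,
      fun h i j => h i (Set.mem_univ i) j (Set.mem_univ j)⟩
  have himage : (fun g : LinearMap.GeneralLinearGroup K V =>
      (LinearMap.toMatrix b b (g : Module.End K V),
        LinearMap.toMatrix b b ((g⁻¹ : LinearMap.GeneralLinearGroup K V) : Module.End K V))) ''
        (intGL b) = ({A : Matrix ι ι K | ∀ i j, A i j ∈ Metric.closedBall (0 : K) 1} ×ˢ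
          {A : Matrix ι ι K | ∀ i j, A i j ∈ Metric.closedBall (0 : K) 1}) ∩
          {p | p.1 * p.2 = 1 ∧ p.2 * p.1 = 1} := by
    ext ⟨A, B⟩
    constructor
    · rintro ⟨g, hg, h⟩
      obtain ⟨hA, hB⟩ := Prod.mk.inj h
      obtain ⟨h1, h2⟩ := (mem_intGL_iff b g).1 hg
      refine ⟨⟨fun i j => ?_, fun i j => ?_⟩, ?_, ?_⟩
      · change A i j ∈ _
        rw [mem_closedBall_zero_iff, ← hA, LinearMap.toMatrix_apply]
        exact h1 i j
      · change B i j ∈ _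
        rw [mem_closedBall_zero_iff, ← hB, LinearMap.toMatrix_apply]
        exact h2 i j
      · change A * B = 1
        rw [← hA, ← hB, ← LinearMap.toMatrix_mul, Units.mul_inv, LinearMap.toMatrix_one]
      · change B * A = 1
        rw [← hA, ← hB, ← LinearMap.toMatrix_mul, Units.inv_mul, LinearMap.toMatrix_one]
    · rintro ⟨⟨h1, h2⟩, hAB, hBA⟩
      change A * B = 1 at hAB
      change B * A = 1 at hBA
      have hf : ∀ M : Matrix ι ι K, LinearMap.toMatrix b b (Matrix.toLin b b M) = M :=
        LinearMap.toMatrix_toLin b b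
      let g : LinearMap.GeneralLinearGroup K V :=
        ⟨Matrix.toLin b b A, Matrix.toLin b b B, by
          rw [Module.End.mul_eq_comp, ← Matrix.toLin_mul, hAB, Matrix.toLin_one]; rfl, by
          rw [Module.End.mul_eq_comp, ← Matrix.toLin_mul, hBA, Matrix.toLin_one]; rfl⟩
      refine ⟨g, (mem_intGL_iff b g).2 ⟨fun i j => ?_, fun i j => ?_⟩,
        Prod.ext (hf A) (hf B)⟩
      · have : A i j ∈ Metric.closedBall (0 : K) 1 := h1 i j
        rw [mem_closedBall_zero_iff, ← hf A, LinearMap.toMatrix_apply] at this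
        exact this
      · have : B i j ∈ Metric.closedBall (0 : K) 1 := h2 i j
        rw [mem_closedBall_zero_iff, ← hf B, LinearMap.toMatrix_apply] at this
        exact this
  rw [himage]
  refine (hB.prod hB).inter_right (IsClosed.and ?_ ?_)
  · exact isClosed_eq (continuous_fst.matrix_mul continuous_snd) continuous_const
  · exact isClosed_eq (continuous_snd.matrix_mul continuous_fst) continuous_const

instance : CompactSpace (U0hat b) := by
  rw [← isCompact_iff_compactSpace, U0hat_eq_image]
  exact (isCompact_intGL b).image continuous_mk

/-! ### The space of seminorm classes -/

omit [IsUltrametricDist K] [LocallyCompactSpace K] [Fintype ι] [Nonempty ι] in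
theorem continuous_NSeminorm_apply (v : V) :
    Continuous fun γ : NSeminorm K V => γ.toFun v :=
  (continuous_apply v).comp continuous_induced_dom

omit [IsUltrametricDist K] [LocallyCompactSpace K] [Fintype ι] [Nonempty ι] in
theorem continuous_SemClass_mk : Continuous (SemClass.mk : NSeminorm K V → SemClass K V) :=
  continuous_quotient_mk'

omit [IsUltrametricDist K] [LocallyCompactSpace K] [Nonempty ι] in
theorem NSeminorm.sum_basis_pos (γ : NSeminorm K V) : 0 < ∑ i, γ.toFun (b i) := by
  refine lt_of_le_of_ne (Finset.sum_nonneg fun i _ => γ.nonneg _) fun h => ?_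
  obtain ⟨v, hv⟩ := γ.ne_zero
  refine hv (le_antisymm (γ.le_of_basis b v le_rfl fun i => ?_) (γ.nonneg v))
  rw [(Finset.sum_eq_zero_iff_of_nonneg fun i _ => γ.nonneg (b i)).1 h.symm i (Finset.mem_univ i),
    mul_zero]

-- Dividing by the sum of the values on the basis gives continuous invariants of a class, and these
-- determine it.
omit [IsUltrametricDist K] [LocallyCompactSpace K] [Nonempty ι] in
include b in
theorem t2Space_SemClass : T2Space (SemClass K V) := by
  let f : SemClass K V → V → ℝ := Quotient.lift
    (fun γ : NSeminorm K V => fun v => γ.toFun v / ∑ i, γ.toFun (b i)) (by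
      rintro γ₁ γ₂ ⟨c, hc, h⟩
      funext v
      simp only [h]
      rw [← Finset.mul_sum, mul_div_mul_left _ _ hc.ne'])
  have hf : Continuous f := by
    refine Continuous.quotient_lift (continuous_pi fun v => ?_) _
    exact (continuous_NSeminorm_apply v).div
      (continuous_finsetSum _ fun i _ => continuous_NSeminorm_apply (b i))
      fun γ => (γ.sum_basis_pos b).ne'
  refine T2Space.of_injective_continuous (f := f) ?_ hf
  intro s s' h
  induction s using Quotient.inductionOn with
  | h γ =>
    induction s' using Quotient.inductionOn with
    | h γ' =>
      have h1 := γ.sum_basis_pos b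
      have h2 := γ'.sum_basis_pos b
      refine SemClass.sound ⟨(∑ i, γ.toFun (b i)) / ∑ i, γ'.toFun (b i), div_pos h1 h2,
        fun v => ?_⟩
      have h3 : γ.toFun v / _ = γ'.toFun v / _ := congrFun h v
      rw [div_eq_iff h1.ne'] at h3
      rw [h3]
      ring

/-- As `GL(V) → PGL(V)` is an open quotient map, its product with the identity of `Ā` is still a
quotient map. Upstairs the normalised representatives vary continuously: each value is a maximum of
finitely many continuous functions. -/
theorem continuous_smul_phi :
    Continuous fun p : PGL K V × ABar ι => p.1 • phi b p.2 := by
  have hQ := one_lt_q_real K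
  rw [← ((isOpenQuotientMap_mk b).prodMap IsOpenQuotientMap.id).isQuotientMap.continuous_iff.symm]
  have : ((fun p : PGL K V × ABar ι => p.1 • phi b p.2) ∘ Prod.map PGL.mk id) =
      fun p : LinearMap.GeneralLinearGroup K V × ABar ι =>
        SemClass.mk (p.1 • wtSem K b p.2) := by
    funext p
    change PGL.mk p.1 • phi b p.2 = _
    rw [phi_eq]
    rfl
  rw [this]
  refine continuous_SemClass_mk.comp (continuous_induced_rng.2 (continuous_pi fun v => ?_))
  change Continuous fun p : LinearMap.GeneralLinearGroup K V × ABar ι =>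
    ⨆ i, ‖b.repr (p.1⁻¹ • v) i‖ * wt (q K) p.2 i
  simp only [← Finset.sup'_univ_eq_ciSup]
  refine Continuous.finset_sup'_apply _ fun i _ => ?_
  exact ((continuous_repr_inv_smul b v i).comp continuous_fst).norm.mul
    ((continuous_apply i).comp ((continuous_wt hQ).comp continuous_snd))

/-! ### Orthogonal bases -/

-- `|γ(v) - γ(w)| ≤ γ(v - w)`, and `γ` is bounded in terms of coordinates, which depend continuously
-- on `g`.
omit [IsUltrametricDist K] [LocallyCompactSpace K] [Nonempty ι] in
include b in
theorem NSeminorm.continuous_smul (γ : NSeminorm K V) (v : V) :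
    Continuous fun g : LinearMap.GeneralLinearGroup K V => γ.toFun (g • v) := by
  refine continuous_iff_continuousAt.2 fun g => ?_
  have hsub : ∀ v w : V, |γ.toFun v - γ.toFun w| ≤ γ.toFun (v - w) := by
    have h1 : ∀ v w : V, γ.toFun v - γ.toFun w ≤ γ.toFun (v - w) := by
      intro v w
      have h := γ.add_le (v - w) w
      rw [sub_add_cancel] at h
      have h1 := γ.nonneg (v - w)
      have h2 := γ.nonneg w
      rcases le_max_iff.1 h with h | h <;> linarith
    intro v w
    refine abs_le.2 ⟨?_, h1 v w⟩
    have h2 := h1 w v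
    have h3 := γ.smul (-1) (v - w)
    rw [neg_one_smul, neg_sub, norm_neg, norm_one, one_mul] at h3
    linarith
  refine tendsto_iff_dist_tendsto_zero.2 (squeeze_zero (fun _ => dist_nonneg)
    (g := fun h => ∑ i, ‖b.repr (h • v) i - b.repr (g • v) i‖ * γ.toFun (b i)) (fun h => ?_) ?_)
  · refine (hsub _ _).trans (γ.le_of_basis b _ ?_ fun i => ?_)
    · exact Finset.sum_nonneg fun i _ => mul_nonneg (norm_nonneg _) (γ.nonneg _)
    · rw [map_sub, Finsupp.sub_apply]
      exact Finset.single_le_sum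
        (f := fun i => ‖b.repr (h • v) i - b.repr (g • v) i‖ * γ.toFun (b i))
        (fun i _ => mul_nonneg (norm_nonneg _) (γ.nonneg _)) (Finset.mem_univ i)
  · have hc : Continuous fun h : LinearMap.GeneralLinearGroup K V =>
        ∑ i, ‖b.repr (h • v) i - b.repr (g • v) i‖ * γ.toFun (b i) :=
      continuous_finsetSum _ fun i _ =>
        (((continuous_repr_smul b v i).sub continuous_const).norm.mul continuous_const)
    have h0 := hc.tendsto g
    simpa using h0

/-- Every seminorm has an orthogonal basis which is a translate of the given basis under
`GL_n(R)`. -/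
theorem exists_intGL_smul_semW (γ : NSeminorm K V) :
    ∃ u ∈ intGL b, ∃ (t : ι → ℝ) (ht : ∀ i, 0 ≤ t i) (ht' : ∃ i, t i ≠ 0),
      γ = u • semW b t ht ht' := by
  classical
  have hQ := one_lt_q_real K
  -- A translated basis minimising the sum of the values of `γ` is orthogonal: any failure of
  -- orthogonality would allow one basis vector to be shortened.
  obtain ⟨u, hu, hmin⟩ := (isCompact_intGL b).exists_isMinOn ⟨1, one_mem _⟩
    (f := fun u => ∑ i, γ.toFun (u • b i))
    (continuous_finsetSum Finset.univ fun i _ => γ.continuous_smul b (b i)).continuousOn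
  set t : ι → ℝ := fun i => γ.toFun (u • b i) with ht
  have htpos : ∀ i, 0 ≤ t i := fun i => γ.nonneg _
  have hle : ∀ v, γ.toFun (u • v) ≤ ⨆ i, ‖b.repr v i‖ * t i := by
    intro v
    have hv : u • v = ∑ i, b.repr v i • u • b i := by
      conv_lhs => rw [← b.sum_repr v, Finset.smul_sum]
      exact Finset.sum_congr rfl fun i _ => smul_comm _ _ _
    rw [hv]
    refine γ.sum_le (Real.iSup_nonneg fun i => mul_nonneg (norm_nonneg _) (htpos i)) _ _
      fun i _ => ?_
    rw [γ.smul]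
    exact le_iSup_weight b t v i
  have hge : ∀ v, ⨆ i, ‖b.repr v i‖ * t i ≤ γ.toFun (u • v) := by
    intro v
    by_contra! hlt
    obtain ⟨i0, hi0⟩ := exists_eq_ciSup_of_finite (f := fun i => ‖b.repr v i‖ * t i)
    set M := ⨆ i, ‖b.repr v i‖ * t i with hM
    have hMpos : 0 < M := (γ.nonneg _).trans_lt hlt
    -- Among the indices that attain `M`, one with the largest coefficient, so that dividing by this
    -- coefficient keeps the others integral.
    obtain ⟨i, hi, hmax⟩ := Finset.exists_max_image
      (Finset.univ.filter fun i => ‖b.repr v i‖ * t i = M) (fun i => ‖b.repr v i‖)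
      ⟨i0, by simpa using hi0⟩
    simp only [Finset.mem_filter, Finset.mem_univ, true_and] at hi hmax
    set J := Finset.univ.filter fun i => ‖b.repr v i‖ * t i = M with hJ
    have hiJ : i ∈ J := by simpa [hJ] using hi
    have hne : b.repr v i ≠ 0 := fun h => by
      rw [h, norm_zero, zero_mul] at hi
      exact hMpos.ne hi
    have hnorm : 0 < ‖b.repr v i‖ := norm_pos_iff.2 hne
    -- the part of `v` supported on the indices where the maximum is attained
    have hv' : γ.toFun (u • ∑ j ∈ J, b.repr v j • b j) < M := by
      have h1 : ∑ j ∈ J, b.repr v j • b j = v + ∑ j ∈ Jᶜ, (-b.repr v j) • b j := by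
        simp only [neg_smul]
        rw [Finset.sum_neg_distrib, ← sub_eq_add_neg, eq_sub_iff_add_eq, Finset.sum_add_sum_compl,
          b.sum_repr]
      rw [h1, smul_add]
      refine (γ.add_le _ _).trans_lt (max_lt hlt ?_)
      rw [Finset.smul_sum]
      refine γ.sum_lt hMpos _ _ fun j hj => ?_
      have h2 : u • (-b.repr v j) • b j = (-b.repr v j) • u • b j := smul_comm _ _ _
      rw [h2, γ.smul, norm_neg]
      refine lt_of_le_of_ne (le_iSup_weight b t v j) fun h => ?_
      rw [hJ, Finset.mem_compl, Finset.mem_filter] at hj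
      exact hj ⟨Finset.mem_univ j, h⟩
    -- `h` replaces `b i` by the part of `v` supported on `J`, divided by its `i`-th coefficient;
    -- the value of `γ ∘ u` there is less than `M / ‖b.repr v i‖ = t i`.
    obtain ⟨h, hh, hhv⟩ := exists_rootSubgroup_column (b := b) (wt (q K) (incl 0)) i
      (fun k => (b.repr v i)⁻¹ * b.repr v k) (J.erase i) (Finset.notMem_erase _ _) (fun k hk => by
        rw [wt_incl_zero hQ, wt_incl_zero hQ]
        refine mul_le_of_le_one_left card_inv_pos.le ?_
        rw [norm_mul, norm_inv, inv_mul_le_iff₀ hnorm, mul_one]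
        have := (Finset.mem_erase.1 hk).2
        rw [hJ, Finset.mem_filter] at this
        exact hmax k this.2)
    have hhi : h • b i = (b.repr v i)⁻¹ • ∑ j ∈ J, b.repr v j • b j := by
      rw [hhv, Module.Basis.repr_self, Finsupp.single_eq_same, one_smul,
        ← Finset.add_sum_erase J _ hiJ, smul_add, smul_smul, inv_mul_cancel₀ hne, one_smul,
        Finset.smul_sum]
      simp only [mul_smul]
    have hhl : ∀ l, l ≠ i → h • b l = b l := fun l hl => by
      rw [hhv, Module.Basis.repr_self, Finsupp.single_eq_of_ne hl.symm, zero_smul, add_zero]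
    have hlt' : ∑ l, γ.toFun ((u * h) • b l) < ∑ l, γ.toFun (u • b l) := by
      have hi' : γ.toFun ((u * h) • b i) < γ.toFun (u • b i) := by
        have h1 : u • (b.repr v i)⁻¹ • ∑ j ∈ J, b.repr v j • b j
            = (b.repr v i)⁻¹ • u • ∑ j ∈ J, b.repr v j • b j := smul_comm _ _ _
        rw [mul_smul, hhi, h1, γ.smul, norm_inv, inv_mul_lt_iff₀ hnorm]
        exact hv'.trans_eq hi.symm
      refine Finset.sum_lt_sum (fun l _ => ?_) ⟨i, Finset.mem_univ i, hi'⟩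
      by_cases hl : l = i
      · rw [hl]
        exact hi'.le
      · rw [mul_smul, hhl l hl]
    exact absurd (hmin (mul_mem hu (rootSubgroup_le_intGL b hh))) (not_le.2 hlt')
  have hγ : ∀ v, γ.toFun v = ⨆ i, ‖b.repr (u⁻¹ • v) i‖ * t i := fun v => by
    refine le_antisymm ?_ ?_
    · simpa using hle (u⁻¹ • v)
    · simpa using hge (u⁻¹ • v)
  have ht' : ∃ i, t i ≠ 0 := by
    by_contra! h
    obtain ⟨v, hv⟩ := γ.ne_zero
    rw [hγ] at hv
    simp [h] at hv
  exact ⟨u, hu, t, htpos, ht', NSeminorm.ext (funext hγ)⟩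

theorem exists_smul_phi_eq (s : SemClass K V) :
    ∃ (u : U0hat b) (x : ABar ι), (u : PGL K V) • phi b x = s := by
  have hQ := one_lt_q_real K
  induction s using Quotient.inductionOn with
  | h γ =>
    obtain ⟨u, hu, t, ht, ht', rfl⟩ := exists_intGL_smul_semW b γ
    have hD : 0 < ∑ i, t i := by
      obtain ⟨i, hi⟩ := ht'
      exact Finset.sum_pos' (fun i _ => ht i) ⟨i, Finset.mem_univ i, lt_of_le_of_ne (ht i) hi.symm⟩
    obtain ⟨x, hx⟩ := exists_wt_eq hQ (t := fun i => t i / ∑ j, t j)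
      ⟨fun i => div_nonneg (ht i) hD.le, by rw [← Finset.sum_div, div_self hD.ne']⟩
    refine ⟨⟨PGL.mk u, U0hat_eq_image b ▸ Set.mem_image_of_mem _ hu⟩, x, ?_⟩
    change PGL.mk u • phi b x = SemClass.mk (u • semW b t ht ht')
    rw [phi_eq, ← SemClass.gl_smul_mk, PGL.mk_smul]
    refine congrArg (u • ·) ((mk_semW_eq_iff b _ _ _ _).2
      ⟨(∑ i, t i)⁻¹, inv_pos.2 hD, fun i => ?_⟩)
    rw [hx]
    ring

end Topologies

/-! ### The compactified building and the space of seminorms -/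

section Main

variable {K : Type*} [NontriviallyNormedField K] [IsUltrametricDist K] [LocallyCompactSpace K]
  {V : Type*} [AddCommGroup V] [Module K V] {ι : Type*} [Fintype ι] [Nonempty ι]
  (b : Module.Basis ι K V)

/-- The map `X̄ → 𝒮` induced by `(u, x) ↦ u(φ(x))`. -/
def toSemClass : XBar b → SemClass K V :=
  Quot.lift (fun p : U0hat b × ABar ι => (p.1 : PGL K V) • phi b p.2)
    fun _ _ h => (BRel_iff b _ _).1 h

theorem toSemClass_mk (u : U0hat b) (x : ABar ι) :
    toSemClass b (XBar.mk b u x) = (u : PGL K V) • phi b x := rfl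

omit [LocallyCompactSpace K] in
theorem exists_XBar_mk_eq (z : XBar b) : ∃ u x, XBar.mk b u x = z := by
  obtain ⟨⟨u, x⟩, h⟩ := Quot.exists_rep z
  exact ⟨u, x, h⟩

theorem toSemClass_bijective : Function.Bijective (toSemClass b) := by
  refine ⟨fun z z' h => ?_, fun s => ?_⟩
  · obtain ⟨u, x, rfl⟩ := exists_XBar_mk_eq b z
    obtain ⟨v, y, rfl⟩ := exists_XBar_mk_eq b z'
    exact Quot.sound ((BRel_iff b ((u : PGL K V), x) ((v : PGL K V), y)).2 h)
  · obtain ⟨u, x, h⟩ := exists_smul_phi_eq b s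
    exact ⟨XBar.mk b u x, h⟩

theorem continuous_toSemClass : Continuous (toSemClass b) :=
  continuous_quot_lift _ ((continuous_smul_phi b).comp
    ((continuous_subtype_val.comp continuous_fst).prodMk continuous_snd))

instance : CompactSpace (XBar b) :=
  inferInstanceAs (CompactSpace (Quot _))

/-- The homeomorphism `X̄ ≃ 𝒮`. -/
def homeoSemClass : XBar b ≃ₜ SemClass K V :=
  haveI := t2Space_SemClass b
  (continuous_toSemClass b).homeoOfEquivCompactToT2
    (f := Equiv.ofBijective (toSemClass b) (toSemClass_bijective b))

theorem homeoSemClass_apply (z : XBar b) : homeoSemClass b z = toSemClass b z := rfl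

/-- The action of `G` on `X̄`, transported from `𝒮`. -/
@[reducible]
def mulActionXBar : MulAction (PGL K V) (XBar b) :=
  (homeoSemClass b).toEquiv.mulAction (PGL K V)

attribute [local instance] mulActionXBar

theorem homeoSemClass_smul (g : PGL K V) (z : XBar b) :
    homeoSemClass b (g • z) = g • homeoSemClass b z :=
  (homeoSemClass b).apply_symm_apply _

theorem homeoSemClass_smul_ofABar (g : PGL K V) (x : ABar ι) :
    homeoSemClass b (g • XBar.ofABar b x) = g • phi b x := by
  rw [homeoSemClass_smul, homeoSemClass_apply, XBar.ofABar, toSemClass_mk, one_smul]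

theorem smul_XBar_mk {g : PGL K V} {u v : U0hat b} {x : ABar ι} {n : N b} {h : PGL K V}
    (hh : h ∈ Px b x) (hg : g * (u : PGL K V) = (v : PGL K V) * n * h) :
    g • XBar.mk b u x = XBar.mk b v (nu b n x) := by
  refine (homeoSemClass b).injective ?_
  rw [homeoSemClass_smul, homeoSemClass_apply, homeoSemClass_apply, toSemClass_mk, toSemClass_mk,
    ← mul_smul, hg, mul_smul, (mem_Px_iff b x h).1 hh, phi_nu, mul_smul]

theorem continuous_smul_ofABar :
    Continuous fun p : PGL K V × ABar ι => p.1 • XBar.ofABar b p.2 := by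
  refine (homeoSemClass b).comp_continuous_iff.1 ?_
  convert continuous_smul_phi b using 1
  exact funext fun p => homeoSemClass_smul_ofABar b p.1 p.2

/-- Restricted to `U_0^∧ × Ā` the map is the projection defining `X̄`; a continuous map is a
quotient map as soon as its composite with a continuous map into its source is one. -/
theorem isQuotientMap_smul_ofABar :
    IsQuotientMap fun p : PGL K V × ABar ι => p.1 • XBar.ofABar b p.2 := by
  refine IsQuotientMap.of_comp
    (f := fun p : U0hat b × ABar ι => ((p.1 : PGL K V), p.2))
    (by fun_prop) (continuous_smul_ofABar b) ?_
  have h : (fun p : PGL K V × ABar ι => p.1 • XBar.ofABar b p.2) ∘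
      (fun p : U0hat b × ABar ι => ((p.1 : PGL K V), p.2)) = fun p => XBar.mk b p.1 p.2 :=
    funext fun p => (homeoSemClass b).injective (homeoSemClass_smul_ofABar b p.1 p.2)
  rw [h]
  exact isQuotientMap_quot_mk

end Main

end SeminormBuilding
end

theorem theorem5p1 {K : Type*} [NontriviallyNormedField K] [IsUltrametricDist K]
    [LocallyCompactSpace K]
    (hK : ∀ ϖ : ValRing K, Irreducible ϖ → ‖(ϖ : K)‖ = ((q K : ℕ) : ℝ)⁻¹)
    {V : Type*} [AddCommGroup V] [Module K V]
    {ι : Type*} [Fintype ι] [Nonempty ι] (b : Module.Basis ι K V) :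
    -- the relation is an equivalence relation, and `G = U_0^∧ N P_x`
    Equivalence (BRel b) ∧
    (∀ (g : PGL K V) (x : ABar ι), ∃ (v : U0hat b) (n : N b) (h : PGL K V),
      h ∈ Px b x ∧ g = (v : PGL K V) * n * h) ∧
    -- the action of `G` on `X̄`
    ∃ _ : MulAction (PGL K V) (XBar b),
      (∀ (g : PGL K V) (u : U0hat b) (x : ABar ι) (v : U0hat b) (n : N b) (h : PGL K V),
        h ∈ Px b x → g * (u : PGL K V) = (v : PGL K V) * n * h →
          g • XBar.mk b u x = XBar.mk b v (nu b n x)) ∧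
      -- `X̄` is the quotient of `G × Ā` by the relation
      IsQuotientMap (fun p : PGL K V × ABar ι => p.1 • XBar.ofABar b p.2) ∧
      (∀ p p' : PGL K V × ABar ι,
        p.1 • XBar.ofABar b p.2 = p'.1 • XBar.ofABar b p'.2 ↔ BRel b p p') ∧
      -- the map `(g, x) ↦ g(φ(x))` induces a `G`-equivariant homeomorphism
      ∃ Φ : XBar b ≃ₜ SemClass K V,
        (∀ (g : PGL K V) (x : ABar ι), Φ (g • XBar.ofABar b x) = g • phi b x) ∧
        ∀ (g : PGL K V) (z : XBar b), Φ (g • z) = g • Φ z := by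
  refine ⟨BRel_equivalence b, exists_eq_U0hat_mul_N_mul_Px b, mulActionXBar b,
    fun g u x v n h hh hg => smul_XBar_mk b hh hg, isQuotientMap_smul_ofABar b, fun p p' => ?_,
    homeoSemClass b, homeoSemClass_smul_ofABar b, homeoSemClass_smul b⟩
  rw [BRel_iff, ← homeoSemClass_smul_ofABar, ← homeoSemClass_smul_ofABar,
    (homeoSemClass b).injective.eq_iff]
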